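/- Let $p\ge 4$. **Model.** Let $y\mapsto q_Y(\|y\|^2)$ be a unimodal spherically symmetric Lebesgue probability density on $\mathbb R^p$, i.e. $q_Y\ge 0$ is nonincreasing on $(0,\infty)$ (possibly unbounded near $0$) and $\int_{\mathbb R^p}q_Y(\|y\|^2)\,dy=1$. Let $F(t)=P(Y_1\le t)$ be the cdf of the first coordinate of a vector $Y$ with this density; $F$ is differentiable on $(0,\infty)$, with derivative $F'$. Let $X\sim p_X(\|x-\mu\|^2)$ with $\mu\in\mathbb R^p$ unknown, where $p_X\ge 0$ is a measurable function on $(0,\infty)$ and the density is with respect to Lebesgue measure or, more generally, with respect to a spherically symmetric measure with radial part given by a $\sigma$-finite measure $\nu$ on $(0,\infty)$: that is, $X-\mu$ has density $z\mapsto p_X(\|z\|^2)$ with respect to the image of $\tfrac12u^{p/2-1}\,d\nu(u)\otimes d\sigma(\theta)$ under $(u,\theta)\mapsto\sqrt u\,\theta$, where $\sigma$ is the surface measure of the unit sphere of $\mathbb R^p$, and the total mass is $1$. For $d\nu(u)=du$ this image measure is Lebesgue measure on $\mathbb R^p$. **Loss and risk.** A predictive density estimator $\hat q(\cdot\,;x)$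 of $q_Y(\|y-\mu\|^2)$ has risk $$R(\mu,\hat q)=E_\mu\Big[\int_{\mathbb R^p}\big|q_Y(\|y-\mu\|^2)-\hat q(y;X)\big|\,dy\Big].$$ $\hat q_1$ dominates $\hat q_2$ if $R(\mu,\hat q_1)\le R(\mu,\hat q_2)$ for all $\mu\in\mathbb R^p$, with strict inequality for at least one $\mu$. **Claim.** Let $a\in\mathbb R$, let $r$ be a real function, and put $\hat\mu_{a,r}(x)=\big(1-a\,r(\|x\|^2)/\|x\|^2\big)x$. Suppose that (i) $0\le r(t)\le 1$ for $t>0$, and $r$ is not identically $0$ on $(0,\infty)$; (ii) $r$ is nondecreasing on $(0,\infty)$; (iii) $t\mapsto r(t)/t$ is nonincreasing on $(0,\infty)$; (iv') $\displaystyle 0<E_\mu\Big[\frac{F'(\|X-\mu\|/2)}{\|X-\mu\|}\Big]<\infty$ (this does not depend on $\mu$); (v') $\displaystyle 0<a\le \frac{2(p-2)}{p}\;\frac{\int_{(0,\infty)}u^{(p-3)/2}\,p_X(u)\,F'(\sqrt u/2)\,d\nu(u)}{\int_{(0,\infty)}u^{(p-5)/2}\,p_X(u)\,F'(\sqrt u/2)\,d\nu(u)}$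 (the right-hand side is $0$ if the denominator is infinite). Then the plug-in density estimator $q_Y(\|y-\hat\mu_{a,r}(X)\|^2)$ dominates the plug-in density estimator $q_Y(\|y-X\|^2)$. -/

import Mathlib

open MeasureTheory Set
open scoped ENNReal

noncomputable section

/-- `ℝ^p` with its Euclidean norm. -/
abbrev Euc (p : ℕ) : Type := EuclideanSpace ℝ (Fin p)

/-- The spherically symmetric reference measure on `ℝ^p` attached to a measure `ν` for the squared
radius: the image of `(u^(p/2-1)/2) dν(u) ⊗ dσ(θ)` on `(0,∞) × S^(p-1)` under `(u, θ) ↦ √u θ`, with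
`σ` the (unnormalized) surface measure. For `ν` the Lebesgue measure this is the Lebesgue measure
of `ℝ^p`, by `sphericalMeasure_volume`. -/
def sphericalMeasure (p : ℕ) (ν : Measure ℝ) : Measure (Euc p) :=
  (((ν.restrict (Ioi 0)).withDensity
      fun u => ENNReal.ofReal (u ^ ((p : ℝ) / 2 - 1) / 2)).prod
    (volume : Measure (Euc p)).toSphere).map fun w => Real.sqrt w.1 • (w.2 : Euc p)

theorem sphericalMeasure_volume (p : ℕ) (hp : 0 < p) :
    sphericalMeasure p volume = (volume : Measure (Euc p)) := by
  have : Nonempty (Fin p) := ⟨⟨0, hp⟩⟩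
  have hmeas : Measurable fun w : ℝ × Metric.sphere (0 : Euc p) 1 =>
      Real.sqrt w.1 • (w.2 : Euc p) := by
    fun_prop
  have hd : Measurable fun u : ℝ => ENNReal.ofReal (u ^ ((p : ℝ) / 2 - 1) / 2) := by
    fun_prop
  refine Measure.ext_of_lintegral _ fun f hf => ?_
  set S := (volume : Measure (Euc p)).toSphere with hS
  have hsec : Measurable fun r : ℝ => ∫⁻ θ, f (r • (θ : Euc p)) ∂S := by
    have : Measurable fun w : ℝ × Metric.sphere (0 : Euc p) 1 => f (w.1 • (w.2 : Euc p)) :=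
      hf.comp (by fun_prop)
    exact this.lintegral_prod_right'
  have h1 : ∫⁻ x, f x ∂(sphericalMeasure p volume) =
      ∫⁻ u in Ioi (0 : ℝ), ENNReal.ofReal (u ^ ((p : ℝ) / 2 - 1) / 2) *
        ∫⁻ θ, f (Real.sqrt u • (θ : Euc p)) ∂S := by
    rw [sphericalMeasure, lintegral_map hf hmeas]
    refine (lintegral_prod _ (hf.comp hmeas).aemeasurable).trans ?_
    exact lintegral_withDensity_eq_lintegral_mul _ hd
      (hsec.comp Real.continuous_sqrt.measurable)
  have h2 : ∫⁻ x, f x ∂(volume : Measure (Euc p)) =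
      ∫⁻ r in Ioi (0 : ℝ), ENNReal.ofReal (r ^ (p - 1)) * ∫⁻ θ, f (r • (θ : Euc p)) ∂S := by
    have e1 : ∫⁻ x, f x ∂(volume : Measure (Euc p)) =
        ∫⁻ x : ({0}ᶜ : Set (Euc p)), f x.1 ∂(volume.comap Subtype.val) := by
      rw [lintegral_subtype_comap (measurableSet_singleton _).compl,
        setLIntegral_congr (compl_mem_ae_iff.2 (measure_singleton _) |> Filter.eventuallyEq_univ.2),
        setLIntegral_univ]
    have mp := (volume : Measure (Euc p)).measurePreserving_homeomorphUnitSphereProd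
    have hg : Measurable fun w : Metric.sphere (0 : Euc p) 1 × Ioi (0 : ℝ) =>
        f (w.2.1 • (w.1 : Euc p)) := hf.comp (by fun_prop)
    have e2 : ∫⁻ x : ({0}ᶜ : Set (Euc p)), f x.1 ∂(volume.comap Subtype.val) =
        ∫⁻ w, f (w.2.1 • (w.1 : Euc p)) ∂(S.prod (Measure.volumeIoiPow (p - 1))) := by
      have hp' : Module.finrank ℝ (Euc p) - 1 = p - 1 := by simp
      rw [← hp', ← mp.lintegral_comp hg]
      refine lintegral_congr fun x => ?_
      congr 1
      have hx : ‖(x : Euc p)‖ ≠ 0 := norm_ne_zero_iff.2 x.2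
      simp [smul_smul, hx]
    have hd' : Measurable fun r : Ioi (0 : ℝ) => ENNReal.ofReal (r.1 ^ (p - 1)) := by fun_prop
    rw [e1, e2, lintegral_prod_symm' _ hg, Measure.volumeIoiPow]
    refine (lintegral_withDensity_eq_lintegral_mul _ hd'
      (hsec.comp measurable_subtype_coe)).trans ?_
    exact lintegral_subtype_comap (μ := volume) measurableSet_Ioi
      (fun r : ℝ => ENNReal.ofReal (r ^ (p - 1)) * ∫⁻ θ, f (r • (θ : Euc p)) ∂S)
  have himg : (fun r : ℝ => r ^ 2) '' Ioi 0 = Ioi 0 := by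
    ext u
    refine ⟨?_, fun hu => ⟨Real.sqrt u, Real.sqrt_pos.2 hu, Real.sq_sqrt (le_of_lt hu)⟩⟩
    rintro ⟨r, hr, rfl⟩
    have hr : 0 < r := hr
    exact pow_pos hr 2
  have hcv := lintegral_image_eq_lintegral_abs_deriv_mul (f := fun r : ℝ => r ^ 2)
    (f' := fun r => 2 * r) (s := Ioi 0) measurableSet_Ioi
    (fun r _ => by simpa using (hasDerivAt_pow 2 r).hasDerivWithinAt)
    (fun x hx y hy h => by
      exact (pow_left_inj₀ (le_of_lt hx) (le_of_lt hy) two_ne_zero).1 h)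
    (fun u => ENNReal.ofReal (u ^ ((p : ℝ) / 2 - 1) / 2) *
        ∫⁻ θ, f (Real.sqrt u • (θ : Euc p)) ∂S)
  rw [himg] at hcv
  rw [h1, h2, hcv]
  refine setLIntegral_congr_fun measurableSet_Ioi fun r hr => ?_
  have hr : 0 < r := hr
  rw [Real.sqrt_sq hr.le, ← mul_assoc, ← ENNReal.ofReal_mul (abs_nonneg _)]
  congr 2
  rw [abs_of_pos (by positivity), ← Real.rpow_natCast r 2, ← Real.rpow_mul hr.le,
    ← Real.rpow_natCast r (p - 1), Nat.cast_sub hp]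
  have : ((2 : ℕ) : ℝ) * ((p : ℝ) / 2 - 1) = ((p : ℝ) - (1 : ℕ)) - 1 := by push_cast; ring
  rw [this, Real.rpow_sub_one hr.ne']
  field_simp

/-- The law of `X - μ`: the spherically symmetric law with density `pX(‖z‖²)` with respect to
`sphericalMeasure p ν`. -/
def noiseLaw (p : ℕ) (ν : Measure ℝ) (pX : ℝ → ℝ) : Measure (Euc p) :=
  (sphericalMeasure p ν).withDensity fun z => ENNReal.ofReal (pX (‖z‖ ^ 2))

/-- The law of `X` when the location parameter is `μ`, i.e. `X ∼ pX(‖x - μ‖²)`. -/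
def obsLaw (p : ℕ) (ν : Measure ℝ) (pX : ℝ → ℝ) (μ : Euc p) : Measure (Euc p) :=
  (noiseLaw p ν pX).map fun z => z + μ

/-- `y ↦ q(‖y‖²)` is a unimodal spherically symmetric Lebesgue probability density on `ℝ^p`.
Unimodality means that `q` is nonincreasing in the radius; the density may be unbounded at its
mode, so nothing is asked of the value `q 0`. -/
structure IsUnimodalSphericalDensity (p : ℕ) (q : ℝ → ℝ) : Prop where
  nonneg : ∀ u, 0 < u → 0 ≤ q u
  unimodal : AntitoneOn q (Ioi 0)
  lintegral_eq_one : ∫⁻ y : Euc p, ENNReal.ofReal (q (‖y‖ ^ 2)) = 1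

/-- `F(t) = P₀(Y₁ ≤ t)`: the cdf of the first coordinate of `Y ∼ q(‖y‖²)`. -/
def marginalCdf (p : ℕ) [NeZero p] (q : ℝ → ℝ) (t : ℝ) : ℝ :=
  ((volume : Measure (Euc p)).withDensity fun y => ENNReal.ofReal (q (‖y‖ ^ 2))).real
    {y | y 0 ≤ t}

/-- A predictive density estimator: `qhat x` is the estimated density of `Y` when `X = x`. -/
abbrev PredictiveEstimator (p : ℕ) : Type := Euc p → Euc p → ℝ

/-- The plug-in density estimator `y ↦ q(‖y - δ(x)‖²)` built on a point estimator `δ` of `μ`. -/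
def plugIn {p : ℕ} (q : ℝ → ℝ) (δ : Euc p → Euc p) : PredictiveEstimator p :=
  fun x y => q (‖y - δ x‖ ^ 2)

/-- Integrated `L₁` loss of the density estimate `g` of `y ↦ q(‖y - μ‖²)`. -/
def l1Loss {p : ℕ} (q : ℝ → ℝ) (μ : Euc p) (g : Euc p → ℝ) : ℝ≥0∞ :=
  ∫⁻ y, ENNReal.ofReal |q (‖y - μ‖ ^ 2) - g y|

/-- Frequentist `L₁` risk at `μ`, i.e. the expected loss under `X ∼ pX(‖x - μ‖²)`. -/
def l1Risk {p : ℕ} (ν : Measure ℝ) (pX q : ℝ → ℝ) (μ : Euc p) (qhat : PredictiveEstimator p) :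
    ℝ≥0∞ :=
  ∫⁻ x, l1Loss q μ (qhat x) ∂(obsLaw p ν pX μ)

/-- `qhat₁` dominates `qhat₂`: its risk is nowhere larger and somewhere smaller. -/
def Dominates {p : ℕ} (ν : Measure ℝ) (pX q : ℝ → ℝ) (qhat₁ qhat₂ : PredictiveEstimator p) :
    Prop :=
  (∀ μ, l1Risk ν pX q μ qhat₁ ≤ l1Risk ν pX q μ qhat₂) ∧
    ∃ μ, l1Risk ν pX q μ qhat₁ < l1Risk ν pX q μ qhat₂

/-- The Baranchik point estimator `(1 - a r(x'x)/(x'x)) x`. -/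
def baranchik {p : ℕ} (a : ℝ) (r : ℝ → ℝ) (x : Euc p) : Euc p :=
  (1 - a * r (‖x‖ ^ 2) / ‖x‖ ^ 2) • x

/-- `∫_(0,∞) u^s pX(u) F'(√u/2) dν(u)`, as an integral of a nonnegative function (possibly `∞`). -/
def radialIntegral (p : ℕ) [NeZero p] (ν : Measure ℝ) (pX q : ℝ → ℝ) (s : ℝ) : ℝ≥0∞ :=
  ∫⁻ u in Ioi (0 : ℝ),
    ENNReal.ofReal (u ^ s * pX u * deriv (marginalCdf p q) (Real.sqrt u / 2)) ∂ν

end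

/-!
The `L₁` distance between the densities `q(‖y - μ‖²)` and `q(‖y - m‖²)` is `4 F(d/2) - 2` with
`d = ‖m - μ‖` (`l1Loss_plugIn`), where `F` is the cdf of a coordinate. Since `q` is unimodal, `F'` is
nonincreasing on `(0, ∞)`, so the loss is a concave function of the squared distance `d²`, with
derivative `w(d) = F'(d/2) / d` (`l1Dist_sub_le`). Hence the risk difference is at most the
difference of the quadratic risks under the law of the noise reweighted by `w`
(`integral_l1Dist_add_le`). The reweighted law is again spherically symmetric, of finite mass, and
`a` is bounded in terms of its mean inverse squared radius. It remains to dominate `X` by the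
shrinkage estimator in quadratic risk for such a law.

Write `X = Z + μ`, `T = ‖X‖²`. As `r ≤ 1`, one has to show that `a E[r(T)/T]` is at most
`2 E[r(T) ⟨Z, X⟩ / T]`. On the sphere `‖Z‖ = R`, let `A(R)` be the mean of `r(T) ⟨Z, X⟩ / T` and
`B(R)` that of `r(T)/T`. Two facts are needed:

* `A(R) ≥ (p - 2)/p * R² * B(R)` (`IsSphereCoordinate.mul_integral_inv_le_integral_crossTerm`);
* `A` is nondecreasing (`IsSphereCoordinate.monotoneOn_integral_crossTerm`).

They give the claim, because `A(R)` and `R⁻²` are oppositely ordered, so that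
`(p - 2)/p * E[B] ≤ E[A R⁻²] ≤ E[A] E[R⁻²]` (`mul_integral_le_of_monotoneOn`). In both facts the
functions involved change sign once as functions of the angle between `Z` and `μ`, and `r` is
nondecreasing, which reduces them to `r = 1`, that is, to statements on the inverse moment
`e(R) = E[1/T]`. Since `p ≥ 4` these are `e(R) (‖μ‖² + (1 - 4/p) R²) ≤ 1` and the monotonicity of
`(R² - ‖μ‖²) e(R)`. Integration by parts on the sphere (`integral_toSphere_inner_mul_inv`) turns
into a first order linear differential equation for `e`; the monotonicity is then Jensen's
inequality, and the bound is a minimum principle.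
-/

/-! ### Inverse moments along a coordinate of the sphere -/

/-- `s` behaves under `σ` like a coordinate of a point distributed on the unit sphere of a space of
dimension `n`: it takes values in `[-1, 1]`, it avoids the pole `-1` almost surely, and the
integration by parts formula `(n - 1) ∫ s g(s) = ∫ (1 - s²) g'(s)` holds for the functions
`g(s) = (K + b s)⁻¹`. -/
structure IsSphereCoordinate {Ω : Type*} [MeasurableSpace Ω] (σ : Measure Ω) (n : ℝ)
    (s : Ω → ℝ) : Prop where
  measurable : Measurable s
  abs_le : ∀ ω, |s ω| ≤ 1
  ae_ne : ∀ᵐ ω ∂σ, s ω ≠ -1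
  parts : ∀ K b : ℝ, |b| < K →
    (n - 1) * ∫ ω, s ω * (K + b * s ω)⁻¹ ∂σ = ∫ ω, (1 - s ω ^ 2) * (-b * ((K + b * s ω) ^ 2)⁻¹) ∂σ

/-- `‖R θ + M u‖²` for unit vectors `θ`, `u` with inner product `x`. -/
def sqDist (M R x : ℝ) : ℝ := R ^ 2 + M ^ 2 + 2 * R * M * x

theorem sqDist_comm (M R x : ℝ) : sqDist M R x = sqDist R M x := by
  unfold sqDist; ring

theorem sq_sub_le_sqDist {M R x : ℝ} (hM : 0 ≤ M) (hR : 0 ≤ R) (hx : |x| ≤ 1) :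
    (R - M) ^ 2 ≤ sqDist M R x := by
  have := (_root_.abs_le.1 hx).1
  unfold sqDist
  nlinarith [mul_nonneg hM hR]

theorem sqDist_nonneg {M R x : ℝ} (hM : 0 ≤ M) (hR : 0 ≤ R) (hx : |x| ≤ 1) :
    0 ≤ sqDist M R x := (sq_nonneg _).trans (sq_sub_le_sqDist hM hR hx)

theorem sqDist_pos {M R x : ℝ} (hM : 0 ≤ M) (hR : 0 ≤ R) (hx : |x| ≤ 1) (h : R ≠ M) :
    0 < sqDist M R x :=
  lt_of_lt_of_le (by have := sub_ne_zero.2 h; positivity) (sq_sub_le_sqDist hM hR hx)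

section InverseMoments

variable {Ω : Type*} [MeasurableSpace Ω] {σ : Measure Ω} {n : ℝ} {s : Ω → ℝ}

/-- The inverse moment `∫ ‖R θ + M u‖⁻²`. -/
noncomputable def invMoment (σ : Measure Ω) (s : Ω → ℝ) (M R : ℝ) : ℝ :=
  ∫ ω, (sqDist M R (s ω))⁻¹ ∂σ

/-- The inverse moment `∫ ‖R θ + M u‖⁻⁴`. -/
noncomputable def invMomentSq (σ : Measure Ω) (s : Ω → ℝ) (M R : ℝ) : ℝ :=
  ∫ ω, ((sqDist M R (s ω)) ^ 2)⁻¹ ∂σ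

theorem invMoment_comm (M R : ℝ) : invMoment σ s M R = invMoment σ s R M := by
  simp only [invMoment, sqDist_comm M R]

theorem invMoment_nonneg {M R : ℝ} (h : IsSphereCoordinate σ n s) (hM : 0 ≤ M) (hR : 0 ≤ R) :
    0 ≤ invMoment σ s M R :=
  integral_nonneg fun ω => inv_nonneg.2 (sqDist_nonneg hM hR (h.abs_le ω))

theorem IsSphereCoordinate.measurable_sqDist (h : IsSphereCoordinate σ n s) (M R : ℝ) :
    Measurable fun ω => sqDist M R (s ω) := by
  have := h.measurable
  unfold sqDist
  fun_prop

theorem IsSphereCoordinate.integral_eq_zero (h : IsSphereCoordinate σ n s) (hn : 4 ≤ n) :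
    ∫ ω, s ω ∂σ = 0 := by
  have := h.parts 1 0 (by simp)
  simp only [zero_mul, add_zero, inv_one, mul_one, neg_zero, mul_zero, integral_zero] at this
  rcases mul_eq_zero.1 this with h1 | h1
  · linarith
  · exact h1

variable [IsFiniteMeasure σ]

theorem IsSphereCoordinate.integrable_inv (h : IsSphereCoordinate σ n s) {M R : ℝ} (hM : 0 ≤ M)
    (hR : 0 ≤ R) (hne : R ≠ M) : Integrable (fun ω => (sqDist M R (s ω))⁻¹) σ := by
  refine Integrable.of_bound (C := ((R - M) ^ 2)⁻¹)
    (h.measurable_sqDist M R).inv.aestronglyMeasurable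
    (Filter.Eventually.of_forall fun ω => ?_)
  have h0 : 0 < (R - M) ^ 2 := by have := sub_ne_zero.2 hne; positivity
  have h1 := sqDist_pos hM hR (h.abs_le ω) hne
  rw [Real.norm_of_nonneg (by positivity)]
  exact inv_anti₀ h0 (sq_sub_le_sqDist hM hR (h.abs_le ω))

theorem IsSphereCoordinate.integrable_inv_sq (h : IsSphereCoordinate σ n s) {M R : ℝ} (hM : 0 ≤ M)
    (hR : 0 ≤ R) (hne : R ≠ M) : Integrable (fun ω => ((sqDist M R (s ω)) ^ 2)⁻¹) σ := by
  refine Integrable.of_bound (C := (((R - M) ^ 2) ^ 2)⁻¹)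
    ((h.measurable_sqDist M R).pow_const 2).inv.aestronglyMeasurable
    (Filter.Eventually.of_forall fun ω => ?_)
  have h0 : 0 < (R - M) ^ 2 := by have := sub_ne_zero.2 hne; positivity
  have h1 := sqDist_pos hM hR (h.abs_le ω) hne
  rw [Real.norm_of_nonneg (by positivity)]
  exact inv_anti₀ (by positivity) (pow_le_pow_left₀ h0.le (sq_sub_le_sqDist hM hR (h.abs_le ω)) 2)

theorem IsSphereCoordinate.integrable (h : IsSphereCoordinate σ n s) : Integrable s σ :=
  Integrable.of_bound (C := 1) h.measurable.aestronglyMeasurable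
    (Filter.Eventually.of_forall fun ω => h.abs_le ω)

/-- Integration by parts expresses the second inverse moment through the first. -/
theorem IsSphereCoordinate.invMomentSq_eq (h : IsSphereCoordinate σ n s) {M R : ℝ} (hM : 0 ≤ M)
    (hR : 0 ≤ R) (hne : R ≠ M) :
    (R ^ 2 - M ^ 2) ^ 2 * invMomentSq σ s M R =
      (n - 2) * σ.real univ - (n - 3) * (R ^ 2 + M ^ 2) * invMoment σ s M R := by
  have hD : 0 < (R - M) ^ 2 := by have := sub_ne_zero.2 hne; positivity
  have hb : |2 * R * M| < R ^ 2 + M ^ 2 := by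
    rw [abs_of_nonneg (by positivity)]; nlinarith
  have hp := congrArg (fun x => (2 * R * M) * x) (h.parts _ _ hb)
  rw [mul_left_comm, ← integral_const_mul (2 * R * M), ← integral_const_mul (2 * R * M)] at hp
  have hV : σ.real univ = ∫ _, (1 : ℝ) ∂σ := by simp
  have i1 := h.integrable_inv hM hR hne
  have i2 := h.integrable_inv_sq hM hR hne
  have e1 : ∫ ω, 2 * R * M * (s ω * (R ^ 2 + M ^ 2 + 2 * R * M * s ω)⁻¹) ∂σ =
      σ.real univ - (R ^ 2 + M ^ 2) * invMoment σ s M R := by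
    rw [invMoment, hV, ← integral_const_mul,
      ← integral_sub (integrable_const _) (i1.const_mul _)]
    refine integral_congr_ae (Filter.Eventually.of_forall fun ω => ?_)
    have hT := sqDist_pos hM hR (h.abs_le ω) hne
    simp only [sqDist] at hT ⊢
    field_simp
    ring
  have e2 : ∫ ω, 2 * R * M * ((1 - s ω ^ 2) *
        (-(2 * R * M) * ((R ^ 2 + M ^ 2 + 2 * R * M * s ω) ^ 2)⁻¹)) ∂σ =
      (R ^ 2 - M ^ 2) ^ 2 * invMomentSq σ s M R
        - 2 * (R ^ 2 + M ^ 2) * invMoment σ s M R + σ.real univ := by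
    rw [invMoment, invMomentSq, hV, ← integral_const_mul ((R ^ 2 - M ^ 2) ^ 2),
      ← integral_const_mul (2 * (R ^ 2 + M ^ 2)), ← integral_sub (i2.const_mul _) (i1.const_mul _),
      ← integral_add (by exact (i2.const_mul _).sub (i1.const_mul _)) (integrable_const _)]
    refine integral_congr_ae (Filter.Eventually.of_forall fun ω => ?_)
    have hT := sqDist_pos hM hR (h.abs_le ω) hne
    simp only [sqDist] at hT ⊢
    field_simp
    ring
  rw [e1, e2] at hp
  linarith

/-- Jensen's inequality for `T ↦ T⁻¹`, the mean of `‖R θ + M u‖²` being `R² + M²`. -/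
theorem IsSphereCoordinate.le_mul_invMoment (h : IsSphereCoordinate σ n s) (hn : 4 ≤ n) {M R : ℝ}
    (hM : 0 ≤ M) (hR : 0 < R) (hne : R ≠ M) :
    σ.real univ ≤ (R ^ 2 + M ^ 2) * invMoment σ s M R := by
  have i1 := h.integrable_inv hM hR.le hne
  have hK : 0 < R ^ 2 + M ^ 2 := by positivity
  have : ∫ ω, (1 - (2 * R * M) / (R ^ 2 + M ^ 2) * s ω) ∂σ ≤
      ∫ ω, (R ^ 2 + M ^ 2) * (sqDist M R (s ω))⁻¹ ∂σ := by
    refine integral_mono ((integrable_const _).sub (h.integrable.const_mul _)) (i1.const_mul _)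
      fun ω => ?_
    have hT := sqDist_pos hM hR.le (h.abs_le ω) hne
    simp only [sqDist] at hT ⊢
    rw [← div_eq_mul_inv, le_div_iff₀ hT]
    have : (R ^ 2 + M ^ 2) * ((1 - 2 * R * M / (R ^ 2 + M ^ 2) * s ω) *
        (R ^ 2 + M ^ 2 + 2 * R * M * s ω)) = (R ^ 2 + M ^ 2) ^ 2 - (2 * R * M * s ω) ^ 2 := by
      field_simp
      ring
    nlinarith [sq_nonneg (2 * R * M * s ω)]
  rw [integral_sub (integrable_const _) (h.integrable.const_mul _), integral_const_mul,
    h.integral_eq_zero hn, integral_const_mul] at this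
  simpa [invMoment] using this

theorem IsSphereCoordinate.hasDerivAt_invMoment (h : IsSphereCoordinate σ n s) {M R : ℝ}
    (hM : 0 ≤ M) (hR : 0 < R) (hne : R ≠ M) :
    HasDerivAt (invMoment σ s M)
      (-(invMoment σ s M R + (R ^ 2 - M ^ 2) * invMomentSq σ s M R) / R) R := by
  set ε := min R |R - M| / 2 with hε
  have hRM : 0 < |R - M| := abs_pos.2 (sub_ne_zero.2 hne)
  have hε0 : 0 < ε := by positivity
  have key : ∀ x ∈ Metric.ball R ε, 0 ≤ x ∧ x ≤ 2 * R ∧ |R - M| / 2 ≤ |x - M| := by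
    intro x hx
    rw [Metric.mem_ball, Real.dist_eq] at hx
    have h1 : ε ≤ R / 2 := by rw [hε]; have := min_le_left R |R - M|; linarith
    have h2 : ε ≤ |R - M| / 2 := by rw [hε]; have := min_le_right R |R - M|; linarith
    have h3 := abs_lt.1 hx
    refine ⟨by linarith, by linarith, ?_⟩
    have : |R - M| ≤ |x - R| + |x - M| := by
      have := abs_sub_abs_le_abs_sub (x - M) (x - R)
      have h5 := abs_sub_le R x M
      rw [abs_sub_comm R x] at h5
      exact h5
    linarith
  have hd := hasDerivAt_integral_of_dominated_loc_of_deriv_le (μ := σ) (x₀ := R)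
    (s := Metric.ball R ε) (F := fun R ω => (sqDist M R (s ω))⁻¹)
    (F' := fun R ω => -(2 * R + 2 * M * s ω) / (sqDist M R (s ω)) ^ 2)
    (bound := fun _ => (4 * R + 2 * M) / ((|R - M| / 2) ^ 2) ^ 2)
    (Metric.ball_mem_nhds R hε0)
    (Filter.Eventually.of_forall fun x => (h.measurable_sqDist M x).inv.aestronglyMeasurable)
    (h.integrable_inv hM hR.le hne)
    (by
      have := h.measurable
      have h2 := h.measurable_sqDist M R
      exact Measurable.aestronglyMeasurable (by fun_prop))
    (Filter.Eventually.of_forall fun ω x hx => by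
      obtain ⟨hx0, hx1, hx2⟩ := key x hx
      have hs := _root_.abs_le.1 (h.abs_le ω)
      have hT := sq_sub_le_sqDist hM hx0 (h.abs_le ω)
      have hq : (|R - M| / 2) ^ 2 ≤ sqDist M x (s ω) := by
        refine le_trans ?_ hT
        rw [← sq_abs (x - M)]
        exact pow_le_pow_left₀ (by positivity) hx2 2
      rw [norm_div, norm_neg, norm_pow, Real.norm_eq_abs, Real.norm_eq_abs, sq_abs]
      gcongr
      rw [_root_.abs_le]
      constructor <;> nlinarith)
    (integrable_const _)
    (Filter.Eventually.of_forall fun ω x hx => by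
      obtain ⟨hx0, hx1, hx2⟩ := key x hx
      have hxM : x ≠ M := by
        rintro rfl
        simp only [sub_self, abs_zero] at hx2
        linarith
      have hT := sqDist_pos hM hx0 (h.abs_le ω) hxM
      have : HasDerivAt (fun R => sqDist M R (s ω)) (2 * x + 2 * M * s ω) x := by
        unfold sqDist
        have := (((hasDerivAt_id x).pow 2).add_const (M ^ 2)).add
          (((hasDerivAt_id x).const_mul 2).mul_const (M * s ω))
        refine (this.congr_deriv ?_).congr_of_eventuallyEq (Filter.Eventually.of_forall fun y => ?_)
        · simp only [id]; push_cast; ring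
        · simp only [Pi.add_apply, Pi.pow_apply, id]; ring
      exact this.inv hT.ne')
  refine hd.2.congr_deriv ?_
  rw [invMoment, invMomentSq, ← integral_const_mul,
    ← integral_add (h.integrable_inv hM hR.le hne) ((h.integrable_inv_sq hM hR.le hne).const_mul _),
    ← integral_neg, ← integral_div]
  refine integral_congr_ae (Filter.Eventually.of_forall fun ω => ?_)
  have hT := sqDist_pos hM hR.le (h.abs_le ω) hne
  simp only
  have e : R * (2 * R + 2 * M * s ω) = sqDist M R (s ω) + (R ^ 2 - M ^ 2) := by
    unfold sqDist; ring
  field_simp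
  linear_combination -e

end InverseMoments

section InverseMomentBounds

variable {Ω : Type*} [MeasurableSpace Ω] {σ : Measure Ω} {n : ℝ} {s : Ω → ℝ} [IsFiniteMeasure σ]

theorem IsSphereCoordinate.hasDerivAt_sub_mul_invMoment (h : IsSphereCoordinate σ n s) {M R : ℝ}
    (hM : 0 ≤ M) (hR : 0 < R) (hne : R ≠ M) :
    HasDerivAt (fun R => (R ^ 2 - M ^ 2) * invMoment σ s M R)
      ((n - 2) / R * ((R ^ 2 + M ^ 2) * invMoment σ s M R - σ.real univ)) R := by
  have h1 := (((hasDerivAt_id R).pow 2).sub_const (M ^ 2)).mul (h.hasDerivAt_invMoment hM hR hne)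
  refine h1.congr_deriv ?_
  have h2 := h.invMomentSq_eq hM hR.le hne
  simp only [Pi.pow_apply, id]
  push_cast
  field_simp
  linear_combination -h2

/-- The mean of `2 ⟨Z, Z + μ⟩ / ‖Z + μ‖² - 1` over the sphere of radius `R` is nondecreasing in
`R`. -/
theorem IsSphereCoordinate.monotoneOn_sub_mul_invMoment (h : IsSphereCoordinate σ n s)
    (hn : 4 ≤ n) {M : ℝ} (hM : 0 ≤ M) :
    MonotoneOn (fun R => (R ^ 2 - M ^ 2) * invMoment σ s M R) (Ioi 0) := by
  have key : ∀ D : Set ℝ, Convex ℝ D → IsOpen D → (∀ x ∈ D, 0 < x ∧ x ≠ M) →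
      MonotoneOn (fun R => (R ^ 2 - M ^ 2) * invMoment σ s M R) D := by
    intro D hD hDo hDx
    refine monotoneOn_of_hasDerivWithinAt_nonneg (f' := fun R =>
      (n - 2) / R * ((R ^ 2 + M ^ 2) * invMoment σ s M R - σ.real univ)) hD
      (fun x hx => (h.hasDerivAt_sub_mul_invMoment hM (hDx x hx).1
        (hDx x hx).2).continuousAt.continuousWithinAt) (fun x hx => ?_) (fun x hx => ?_)
    · rw [hDo.interior_eq] at hx
      exact (h.hasDerivAt_sub_mul_invMoment hM (hDx x hx).1 (hDx x hx).2).hasDerivWithinAt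
    · rw [hDo.interior_eq] at hx
      have h1 := (hDx x hx).1
      have := h.le_mul_invMoment hn hM h1 (hDx x hx).2
      exact mul_nonneg (div_nonneg (by linarith) h1.le) (by linarith)
  have k1 := key (Ioo 0 M) (convex_Ioo _ _) isOpen_Ioo fun x hx => ⟨hx.1, hx.2.ne⟩
  have k2 := key (Ioi M) (convex_Ioi _) isOpen_Ioi fun x hx => ⟨lt_of_le_of_lt hM hx, ne_of_gt hx⟩
  have s1 : ∀ x, 0 < x → x ≤ M → (x ^ 2 - M ^ 2) * invMoment σ s M x ≤ 0 := fun x h0 hx =>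
    mul_nonpos_of_nonpos_of_nonneg (by nlinarith) (invMoment_nonneg h hM h0.le)
  have s2 : ∀ x, 0 < x → M ≤ x → 0 ≤ (x ^ 2 - M ^ 2) * invMoment σ s M x := fun x h0 hx =>
    mul_nonneg (by nlinarith) (invMoment_nonneg h hM h0.le)
  intro x hx y hy hxy
  have hx : 0 < x := hx
  have hy : 0 < y := hy
  rcases lt_or_ge M x with h1 | h1
  · exact k2 h1 (h1.trans_le hxy) hxy
  · rcases lt_or_ge y M with h2 | h2
    · exact k1 ⟨hx, lt_of_le_of_lt hxy h2⟩ ⟨hy, h2⟩ hxy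
    · exact (s1 x hx h1).trans (s2 y hy h2)

/-- The upper bound for the inverse moment inside the sphere of radius `M`. At a minimum of
`σ(1) - invMoment * (M² + (1 - 4/n) R²)` the differential equation of `invMoment` forces this
function to be nonnegative, and it tends to `0` as `R → 0`. -/
theorem IsSphereCoordinate.invMoment_mul_le_of_lt (h : IsSphereCoordinate σ n s) (hn : 4 ≤ n)
    {M R : ℝ} (hR : 0 < R) (hRM : R < M) :
    invMoment σ s M R * (M ^ 2 + (1 - 4 / n) * R ^ 2) ≤ σ.real univ := by
  have hM : 0 < M := hR.trans hRM
  have hn0 : 0 < n := by linarith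
  set c := 1 - 4 / n with hc
  have hc0 : 0 ≤ c := by rw [hc, sub_nonneg, div_le_one hn0]; exact hn
  have hcn : c * n = n - 4 := by rw [hc]; field_simp
  set w : ℝ → ℝ := fun x => σ.real univ - invMoment σ s M x * (M ^ 2 + c * x ^ 2) with hw
  by_contra hcon
  have hwR : w R < 0 := by simp only [hw]; linarith
  have hlow : ∀ x, 0 < x → x < M →
      σ.real univ - σ.real univ * ((M - x) ^ 2)⁻¹ * (M ^ 2 + c * x ^ 2) ≤ w x := by
    intro x hx hxM
    have : invMoment σ s M x ≤ σ.real univ * ((M - x) ^ 2)⁻¹ := by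
      have h0 : 0 < (M - x) ^ 2 := by have := sub_pos.2 hxM; positivity
      have := integral_mono (h.integrable_inv hM.le hx.le hxM.ne)
        (integrable_const (((M - x) ^ 2)⁻¹)) fun ω => by
          refine inv_anti₀ h0 ?_
          have := sq_sub_le_sqDist hM.le hx.le (h.abs_le ω)
          calc (M - x) ^ 2 = (x - M) ^ 2 := by ring
            _ ≤ _ := this
      simpa [invMoment] using this
    simp only [hw]
    have : 0 ≤ M ^ 2 + c * x ^ 2 := by positivity
    gcongr
  obtain ⟨δ, hδ0, hδR, hδ⟩ : ∃ δ, 0 < δ ∧ δ < R ∧ w R < w δ := by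
    have ht : Filter.Tendsto (fun x =>
        σ.real univ - σ.real univ * ((M - x) ^ 2)⁻¹ * (M ^ 2 + c * x ^ 2)) (nhdsWithin 0 (Ioi 0))
        (nhds 0) := by
      have : ContinuousAt (fun x =>
        σ.real univ - σ.real univ * ((M - x) ^ 2)⁻¹ * (M ^ 2 + c * x ^ 2)) 0 := by
        have : (M - 0) ^ 2 ≠ 0 := by rw [sub_zero]; positivity
        fun_prop (disch := assumption)
      have h2 := this.tendsto
      have e : σ.real univ - σ.real univ * ((M - 0) ^ 2)⁻¹ * (M ^ 2 + c * 0 ^ 2) = 0 := by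
        have := hM.ne'
        field_simp
        ring
      rw [e] at h2
      exact h2.mono_left nhdsWithin_le_nhds
    obtain ⟨δ, h1, h2⟩ := ((ht.eventually (lt_mem_nhds hwR)).and
      (Ioo_mem_nhdsGT hR)).exists
    exact ⟨δ, h2.1, h2.2, h1.trans_le (hlow δ h2.1 (h2.2.trans hRM))⟩
  have hderiv : ∀ x, 0 < x → x < M → HasDerivAt w
      ((invMoment σ s M x + (x ^ 2 - M ^ 2) * invMomentSq σ s M x) / x * (M ^ 2 + c * x ^ 2)
        - invMoment σ s M x * (2 * c * x)) x := by
    intro x hx hxM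
    have h1 := ((h.hasDerivAt_invMoment hM.le hx hxM.ne).mul
      ((((hasDerivAt_id x).pow 2).const_mul c).const_add (M ^ 2))).const_sub (σ.real univ)
    refine h1.congr_deriv ?_
    simp only [Pi.pow_apply, id]
    push_cast
    field_simp
    ring
  obtain ⟨x, hx, hmin⟩ := isCompact_Icc.exists_isMinOn (nonempty_Icc.2 hδR.le)
    (fun x hx => (hderiv x (hδ0.trans_le hx.1) (hx.2.trans_lt hRM)).continuousAt.continuousWithinAt
      : ContinuousOn w (Icc δ R))
  have hxR : w x ≤ w R := hmin ⟨hδR.le, le_rfl⟩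
  have hδx : δ < x := lt_of_le_of_ne hx.1 (by rintro rfl; linarith)
  have hx0 : 0 < x := hδ0.trans hδx
  have hxM : x < M := hx.2.trans_lt hRM
  have hd := hderiv x hx0 hxM
  have hle : (invMoment σ s M x + (x ^ 2 - M ^ 2) * invMomentSq σ s M x) / x * (M ^ 2 + c * x ^ 2)
        - invMoment σ s M x * (2 * c * x) ≤ 0 := by
    have hm := (hmin.localize).hasFDerivWithinAt_nonneg hd.hasFDerivAt.hasFDerivWithinAt
      (y := δ - x) (sub_mem_posTangentConeAt_of_segment_subset
        ((convex_Icc δ R).segment_subset hx ⟨le_rfl, hδR.le⟩))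
    simp only [ContinuousLinearMap.toSpanSingleton_apply, smul_eq_mul] at hm
    nlinarith
  have hq := h.invMomentSq_eq hM.le hx0.le hxM.ne
  have hwx : w x < 0 := hxR.trans_lt hwR
  have hV : σ.real univ = w x + invMoment σ s M x * (M ^ 2 + c * x ^ 2) := by simp [hw]
  have he := invMoment_nonneg h hM.le hx0.le
  rw [hV] at hq
  generalize invMoment σ s M x = e at *
  generalize invMomentSq σ s M x = e2 at *
  generalize w x = v at *
  have hd0 : 0 < M ^ 2 - x ^ 2 := by nlinarith
  have hN : 0 < M ^ 2 + c * x ^ 2 := by positivity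
  have h1 : (e + (x ^ 2 - M ^ 2) * e2) * (M ^ 2 + c * x ^ 2) - 2 * c * e * x ^ 2 ≤ 0 := by
    have h2 := mul_nonpos_of_nonneg_of_nonpos hx0.le hle
    have h3 : x * ((e + (x ^ 2 - M ^ 2) * e2) / x * (M ^ 2 + c * x ^ 2) - e * (2 * c * x)) =
        (e + (x ^ 2 - M ^ 2) * e2) * (M ^ 2 + c * x ^ 2) - 2 * c * e * x ^ 2 := by
      field_simp
    linarith
  have h2 := mul_nonpos_of_nonneg_of_nonpos hd0.le h1
  have h3 : (M ^ 2 - x ^ 2) * ((e + (x ^ 2 - M ^ 2) * e2) * (M ^ 2 + c * x ^ 2)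
        - 2 * c * e * x ^ 2) =
      2 * c * e * x ^ 2 * ((c + 1) * x ^ 2) - (n - 2) * v * (M ^ 2 + c * x ^ 2) := by
    linear_combination (-(M ^ 2 + c * x ^ 2)) * hq - e * x ^ 2 * (M ^ 2 + c * x ^ 2) * hcn
  have h4 : 0 < -v * ((n - 2) * (M ^ 2 + c * x ^ 2)) :=
    mul_pos (by linarith) (mul_pos (by linarith) hN)
  have h5 : 0 ≤ 2 * c * e * x ^ 2 * ((c + 1) * x ^ 2) := by positivity
  nlinarith

end InverseMomentBounds

section InverseMomentAll

variable {Ω : Type*} [MeasurableSpace Ω] {σ : Measure Ω} {n : ℝ} {s : Ω → ℝ} [IsFiniteMeasure σ]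

omit [IsFiniteMeasure σ] in
theorem IsSphereCoordinate.ae_sqDist_pos (h : IsSphereCoordinate σ n s) {M R : ℝ} (hM : 0 ≤ M)
    (hR : 0 < R) : ∀ᵐ ω ∂σ, 0 < sqDist M R (s ω) := by
  by_cases hne : R = M
  · subst hne
    filter_upwards [h.ae_ne] with ω hω
    have := lt_of_le_of_ne (_root_.abs_le.1 (h.abs_le ω)).1 (Ne.symm hω)
    have e : sqDist R R (s ω) = 2 * R ^ 2 * (1 + s ω) := by unfold sqDist; ring
    rw [e]
    have : 0 < 1 + s ω := by linarith
    positivity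
  · exact Filter.Eventually.of_forall fun ω => sqDist_pos hM hR.le (h.abs_le ω) hne

/-- On the critical sphere `R = M`, the bound passes to the limit by Fatou's lemma. -/
theorem IsSphereCoordinate.lintegral_inv_self_le (h : IsSphereCoordinate σ n s) (hn : 4 ≤ n)
    {M : ℝ} (hM : 0 < M) :
    ∫⁻ ω, ENNReal.ofReal ((sqDist M M (s ω))⁻¹) ∂σ ≤
      ENNReal.ofReal (σ.real univ / (M ^ 2 + (1 - 4 / n) * M ^ 2)) := by
  have hc0 : 0 ≤ 1 - 4 / n := by rw [sub_nonneg, div_le_one (by linarith)]; exact hn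
  set u : ℕ → ℝ := fun k => M * (1 - 1 / ((k : ℝ) + 2)) with hu
  have hu0 : ∀ k, 0 < u k ∧ u k < M := fun k => by
    have h1 : 1 / ((k : ℝ) + 2) < 1 := by
      rw [div_lt_one (by positivity)]; linarith [k.cast_nonneg (α := ℝ)]
    have h2 : 0 < 1 / ((k : ℝ) + 2) := by positivity
    exact ⟨mul_pos hM (by linarith), by simp only [hu]; nlinarith⟩
  have hut : Filter.Tendsto u Filter.atTop (nhds M) := by
    have h1 : Filter.Tendsto (fun k : ℕ => 1 / ((k : ℝ) + 2)) Filter.atTop (nhds 0) :=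
      (tendsto_one_div_add_atTop_nhds_zero_nat.comp (Filter.tendsto_add_atTop_nat 1)).congr
        fun k => by simp only [Function.comp]; push_cast; ring_nf
    have h2 := (h1.const_sub 1).const_mul M
    simpa [hu] using h2
  have hlim : ∀ᵐ ω ∂σ, ENNReal.ofReal ((sqDist M M (s ω))⁻¹) =
      Filter.liminf (fun k => ENNReal.ofReal ((sqDist M (u k) (s ω))⁻¹)) Filter.atTop := by
    filter_upwards [h.ae_sqDist_pos hM.le hM] with ω hω
    refine (Filter.Tendsto.liminf_eq (ENNReal.tendsto_ofReal (Filter.Tendsto.inv₀ ?_ hω.ne'))).symm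
    have : Continuous fun R => sqDist M R (s ω) := by unfold sqDist; fun_prop
    exact (this.tendsto M).comp hut
  rw [lintegral_congr_ae hlim]
  refine (lintegral_liminf_le fun k => (h.measurable_sqDist M (u k)).inv.ennreal_ofReal).trans ?_
  have hbd : ∀ k, ∫⁻ ω, ENNReal.ofReal ((sqDist M (u k) (s ω))⁻¹) ∂σ ≤
      ENNReal.ofReal (σ.real univ / (M ^ 2 + (1 - 4 / n) * (u k) ^ 2)) := fun k => by
    rw [← ofReal_integral_eq_lintegral_ofReal (h.integrable_inv hM.le (hu0 k).1.le (hu0 k).2.ne)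
      (Filter.Eventually.of_forall fun ω =>
        inv_nonneg.2 (sqDist_nonneg hM.le (hu0 k).1.le (h.abs_le ω)))]
    refine ENNReal.ofReal_le_ofReal ?_
    rw [le_div_iff₀ (by positivity)]
    exact h.invMoment_mul_le_of_lt hn (hu0 k).1 (hu0 k).2
  refine (Filter.liminf_le_liminf (Filter.Eventually.of_forall hbd)).trans
    (Filter.Tendsto.liminf_eq (ENNReal.tendsto_ofReal ?_)).le
  exact tendsto_const_nhds.div (((hut.pow 2).const_mul _).const_add _) (by positivity)

theorem IsSphereCoordinate.integrable_inv_sqDist (h : IsSphereCoordinate σ n s) (hn : 4 ≤ n)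
    {M R : ℝ} (hM : 0 ≤ M) (hR : 0 < R) :
    Integrable (fun ω => (sqDist M R (s ω))⁻¹) σ := by
  by_cases hne : R = M
  · subst hne
    refine ⟨(h.measurable_sqDist R R).inv.aestronglyMeasurable, ?_⟩
    rw [hasFiniteIntegral_iff_ofReal (Filter.Eventually.of_forall fun ω =>
        inv_nonneg.2 (sqDist_nonneg hM hM (h.abs_le ω)))]
    exact (h.lintegral_inv_self_le hn hR).trans_lt ENNReal.ofReal_lt_top
  · exact h.integrable_inv hM hR.le hne

omit [IsFiniteMeasure σ] in
theorem invMoment_zero (R : ℝ) : invMoment σ s 0 R = σ.real univ * (R ^ 2)⁻¹ := by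
  simp [invMoment, sqDist]

theorem IsSphereCoordinate.invMoment_mul_le (h : IsSphereCoordinate σ n s) (hn : 4 ≤ n)
    {M R : ℝ} (hM : 0 ≤ M) (hR : 0 < R) :
    invMoment σ s M R * (M ^ 2 + (1 - 4 / n) * R ^ 2) ≤ σ.real univ ∧
      invMoment σ s M R * R ^ 2 ≤ σ.real univ := by
  have hc0 : 0 ≤ 1 - 4 / n := by rw [sub_nonneg, div_le_one (by linarith)]; exact hn
  have hc1 : 1 - 4 / n ≤ 1 := by have : 0 ≤ 4 / n := by positivity
                                 linarith
  have he := invMoment_nonneg h hM hR.le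
  set c := 1 - 4 / n with hc
  rcases hM.eq_or_lt with rfl | hM0
  · have e : invMoment σ s 0 R * R ^ 2 = σ.real univ := by
      rw [invMoment_zero]; field_simp
    refine ⟨?_, e.le⟩
    nlinarith [mul_nonneg he (sq_nonneg R)]
  rcases lt_trichotomy R M with hlt | rfl | hlt
  · have h1 := h.invMoment_mul_le_of_lt hn hR hlt
    refine ⟨h1, le_trans (mul_le_mul_of_nonneg_left ?_ he) h1⟩
    nlinarith [mul_nonneg hc0 (sq_nonneg R)]
  · have h1 := h.lintegral_inv_self_le hn hR
    rw [← ofReal_integral_eq_lintegral_ofReal (h.integrable_inv_sqDist hn hM hR)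
      (Filter.Eventually.of_forall fun ω => inv_nonneg.2 (sqDist_nonneg hM hM (h.abs_le ω))),
      ENNReal.ofReal_le_ofReal_iff (by positivity), le_div_iff₀ (by positivity)] at h1
    refine ⟨h1, le_trans (mul_le_mul_of_nonneg_left ?_ he) h1⟩
    nlinarith [mul_nonneg hc0 (sq_nonneg R)]
  · have h1 := h.invMoment_mul_le_of_lt hn hM0 hlt
    rw [invMoment_comm] at h1
    refine ⟨le_trans (mul_le_mul_of_nonneg_left ?_ he) h1,
      le_trans (mul_le_mul_of_nonneg_left ?_ he) h1⟩
    · have : 0 ≤ (1 - c) * (R ^ 2 - M ^ 2) := mul_nonneg (by linarith) (by nlinarith)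
      linarith
    · have := mul_nonneg hc0 (sq_nonneg M)
      linarith

end InverseMomentAll

/-! ### The cross term over a sphere -/

/-- `⟨Z, X⟩ / ‖X‖²` for `X = Z + μ`, `‖Z‖ = R`, `‖μ‖ = M`, as a function of the cosine `x` of the
angle between `Z` and `μ`. -/
noncomputable def crossTerm (M R x : ℝ) : ℝ := 1 / 2 + (R ^ 2 - M ^ 2) / 2 * (sqDist M R x)⁻¹

section CrossTerm

variable {Ω : Type*} [MeasurableSpace Ω] {σ : Measure Ω} {n : ℝ} {s : Ω → ℝ} [IsFiniteMeasure σ]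
  {r : ℝ → ℝ}

omit [IsFiniteMeasure σ] in
theorem IsSphereCoordinate.integrable_comp_mul (h : IsSphereCoordinate σ n s)
    (hr : Monotone r) (hr0 : ∀ t, 0 ≤ r t) (hr1 : ∀ t, r t ≤ 1) (M R : ℝ) {g : Ω → ℝ}
    (hg : Integrable g σ) : Integrable (fun ω => r (sqDist M R (s ω)) * g ω) σ :=
  hg.bdd_mul (c := 1) (hr.measurable.comp (h.measurable_sqDist M R)).aestronglyMeasurable
    (Filter.Eventually.of_forall fun ω => by
      rw [Real.norm_of_nonneg (hr0 _)]; exact hr1 _)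

theorem IsSphereCoordinate.integrable_crossTerm (h : IsSphereCoordinate σ n s) (hn : 4 ≤ n)
    {M R : ℝ} (hM : 0 ≤ M) (hR : 0 < R) : Integrable (fun ω => crossTerm M R (s ω)) σ :=
  (integrable_const _).add ((h.integrable_inv_sqDist hn hM hR).const_mul _)

theorem IsSphereCoordinate.integral_crossTerm (h : IsSphereCoordinate σ n s) (hn : 4 ≤ n)
    {M R : ℝ} (hM : 0 ≤ M) (hR : 0 < R) :
    ∫ ω, crossTerm M R (s ω) ∂σ =
      (σ.real univ + (R ^ 2 - M ^ 2) * invMoment σ s M R) / 2 := by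
  unfold crossTerm
  rw [integral_add (integrable_const _) ((h.integrable_inv_sqDist hn hM hR).const_mul _),
    integral_const_mul, invMoment]
  simp
  ring

/-- The cross term dominates a multiple of the quadratic term on every sphere. Their difference
`(T - T₀) / (2 T)`, with `T₀ = M² + (1 - 4/n) R²`, changes sign once and has nonnegative mean, so a
nondecreasing weight `r(T)` keeps the mean nonnegative. -/
theorem IsSphereCoordinate.mul_integral_inv_le_integral_crossTerm (h : IsSphereCoordinate σ n s)
    (hn : 4 ≤ n) (hr : Monotone r) (hr0 : ∀ t, 0 ≤ r t) (hr1 : ∀ t, r t ≤ 1) {M R : ℝ}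
    (hM : 0 ≤ M) (hR : 0 < R) :
    (n - 2) / n * R ^ 2 * ∫ ω, r (sqDist M R (s ω)) * (sqDist M R (s ω))⁻¹ ∂σ ≤
      ∫ ω, r (sqDist M R (s ω)) * crossTerm M R (s ω) ∂σ := by
  have hn0 : n ≠ 0 := by linarith
  set T₀ := M ^ 2 + (1 - 4 / n) * R ^ 2 with hT₀
  have hi := h.integrable_inv_sqDist hn hM hR
  have hk : Integrable (fun ω => 1 / 2 - T₀ / 2 * (sqDist M R (s ω))⁻¹) σ :=
    (integrable_const _).sub (hi.const_mul _)
  have hmean : 0 ≤ ∫ ω, (1 / 2 - T₀ / 2 * (sqDist M R (s ω))⁻¹) ∂σ := by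
    rw [integral_sub (integrable_const _) (hi.const_mul _), integral_const_mul]
    have := (h.invMoment_mul_le hn hM hR).1
    simp only [integral_const, smul_eq_mul]
    unfold invMoment at this
    linarith
  have hmono : ∫ ω, r T₀ * (1 / 2 - T₀ / 2 * (sqDist M R (s ω))⁻¹) ∂σ ≤
      ∫ ω, r (sqDist M R (s ω)) * (1 / 2 - T₀ / 2 * (sqDist M R (s ω))⁻¹) ∂σ := by
    refine integral_mono_ae (hk.const_mul _) (h.integrable_comp_mul hr hr0 hr1 M R hk) ?_
    filter_upwards [h.ae_sqDist_pos hM hR] with ω hω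
    have e : 1 / 2 - T₀ / 2 * (sqDist M R (s ω))⁻¹ =
        (sqDist M R (s ω) - T₀) / (2 * sqDist M R (s ω)) := by field_simp
    rcases le_total T₀ (sqDist M R (s ω)) with h1 | h1
    · exact mul_le_mul_of_nonneg_right (hr h1)
        (by rw [e]; exact div_nonneg (by linarith) (by linarith))
    · exact mul_le_mul_of_nonpos_right (hr h1)
        (by rw [e]; exact div_nonpos_of_nonpos_of_nonneg (by linarith) (by linarith))
  rw [integral_const_mul] at hmono
  have h2 := (mul_nonneg (hr0 T₀) hmean).trans hmono
  have h3 : ∫ ω, r (sqDist M R (s ω)) * (1 / 2 - T₀ / 2 * (sqDist M R (s ω))⁻¹) ∂σ =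
      (∫ ω, r (sqDist M R (s ω)) * crossTerm M R (s ω) ∂σ) -
      (n - 2) / n * R ^ 2 * ∫ ω, r (sqDist M R (s ω)) * (sqDist M R (s ω))⁻¹ ∂σ := by
    rw [← integral_const_mul, ← integral_sub
      (h.integrable_comp_mul hr hr0 hr1 M R (h.integrable_crossTerm hn hM hR))
      ((h.integrable_comp_mul hr hr0 hr1 M R hi).const_mul _)]
    refine integral_congr_ae (Filter.Eventually.of_forall fun ω => ?_)
    simp only [crossTerm, hT₀]
    field_simp
    ring
  linarith

/-- Pointwise comparison of the weighted cross terms on two spheres. The minimum over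
`R ∈ [R₁, R₂]` of `sqDist M R x` is attained at the projection of `-M x` on `[R₁, R₂]`. -/
theorem le_sub_crossTerm (hr : Monotone r) {M R₁ R₂ x : ℝ} (h1 : 0 < R₁)
    (h12 : R₁ ≤ R₂) (hT1 : 0 < sqDist M R₁ x) (hT2 : 0 < sqDist M R₂ x) :
    r (sqDist M (max R₁ (min R₂ (-(M * x)))) x) * (crossTerm M R₂ x - crossTerm M R₁ x) ≤
      r (sqDist M R₂ x) * crossTerm M R₂ x - r (sqDist M R₁ x) * crossTerm M R₁ x := by
  -- The cross term has the sign of `R + M x`, and so has the derivative of `sqDist M R x` in `R`.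
  -- The cross term has the sign of `R + M x`, and so has the derivative of `sqDist M R x` in `R`.
  have e : ∀ R, 0 < sqDist M R x → crossTerm M R x = R * (R + M * x) / sqDist M R x := by
    intro R hT
    unfold crossTerm
    field_simp
    unfold sqDist
    ring
  have h2 : 0 < R₂ := h1.trans_le h12
  have e1 := e R₁ hT1
  have e2 := e R₂ hT2
  rcases le_total (R₁ + M * x) 0 with ha | ha
  · have f1 : crossTerm M R₁ x ≤ 0 := by
      rw [e1]; exact div_nonpos_of_nonpos_of_nonneg (mul_nonpos_of_nonneg_of_nonpos h1.le ha) hT1.le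
    rcases le_total (R₂ + M * x) 0 with hb | hb
    · have hm : max R₁ (min R₂ (-(M * x))) = R₂ := by
        rw [min_eq_left (by linarith), max_eq_right h12]
      have : sqDist M R₂ x ≤ sqDist M R₁ x := by unfold sqDist; nlinarith
      rw [hm]
      nlinarith [mul_le_mul_of_nonpos_right (hr this) f1]
    · have hm : max R₁ (min R₂ (-(M * x))) = -(M * x) := by
        rw [min_eq_right (by linarith), max_eq_right (by linarith)]
      have f2 : 0 ≤ crossTerm M R₂ x := by
        rw [e2]; positivity
      rw [hm]
      have g1 : sqDist M (-(M * x)) x ≤ sqDist M R₁ x := by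
        unfold sqDist; nlinarith [sq_nonneg (R₁ + M * x)]
      have g2 : sqDist M (-(M * x)) x ≤ sqDist M R₂ x := by
        unfold sqDist; nlinarith [sq_nonneg (R₂ + M * x)]
      nlinarith [mul_le_mul_of_nonpos_right (hr g1) f1, mul_le_mul_of_nonneg_right (hr g2) f2]
  · have hm : max R₁ (min R₂ (-(M * x))) = R₁ := max_eq_left ((min_le_right _ _).trans (by linarith))
    have f2 : 0 ≤ crossTerm M R₂ x := by
      rw [e2]; exact div_nonneg (mul_nonneg h2.le (by linarith)) hT2.le
    have : sqDist M R₁ x ≤ sqDist M R₂ x := by unfold sqDist; nlinarith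
    rw [hm]
    nlinarith [mul_le_mul_of_nonneg_right (hr this) f2]

theorem sqDist_clamp_mono {M R₁ R₂ x y : ℝ} (hM : 0 ≤ M) (h1 : 0 < R₁) (h12 : R₁ ≤ R₂)
    (hxy : x ≤ y) :
    sqDist M (max R₁ (min R₂ (-(M * x)))) x ≤ sqDist M (max R₁ (min R₂ (-(M * y)))) y := by
  set b := max R₁ (min R₂ (-(M * y))) with hb
  have hb1 : R₁ ≤ b := le_max_left _ _
  have hb2 : b ≤ R₂ := max_le h12 (min_le_left _ _)
  have hmin : sqDist M (max R₁ (min R₂ (-(M * x)))) x ≤ sqDist M b x := by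
    have e : ∀ R, sqDist M R x = (R + M * x) ^ 2 + (M ^ 2 - (M * x) ^ 2) := by
      intro R; unfold sqDist; ring
    rw [e, e]
    gcongr ?_ + _
    rcases le_total R₁ (-(M * x)) with h3 | h3
    · rcases le_total R₂ (-(M * x)) with h4 | h4
      · rw [min_eq_left h4, max_eq_right h12]; nlinarith
      · rw [min_eq_right h4, max_eq_right h3]; nlinarith [sq_nonneg (b + M * x)]
    · rw [max_eq_left ((min_le_right _ _).trans h3)]; nlinarith
  refine hmin.trans ?_
  unfold sqDist
  have : 0 ≤ b * M * (y - x) := mul_nonneg (mul_nonneg (h1.le.trans hb1) hM) (by linarith)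
  linarith

/-- The mean over the sphere of radius `R` of the weighted cross term is nondecreasing in `R`.
The increment of the cross term between two radii changes sign once, at `x₀`, and has nonnegative
mean. -/
theorem IsSphereCoordinate.monotoneOn_integral_crossTerm (h : IsSphereCoordinate σ n s)
    (hn : 4 ≤ n) (hr : Monotone r) (hr0 : ∀ t, 0 ≤ r t) (hr1 : ∀ t, r t ≤ 1) {M : ℝ}
    (hM : 0 ≤ M) :
    MonotoneOn (fun R => ∫ ω, r (sqDist M R (s ω)) * crossTerm M R (s ω) ∂σ) (Ioi 0) := by
  intro R₁ hR1 R₂ hR2 h12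
  have hR1 : 0 < R₁ := hR1
  have hR2 : 0 < R₂ := hR2
  have c1 := h.integrable_crossTerm hn hM hR1
  have c2 := h.integrable_crossTerm hn hM hR2
  have i1 := h.integrable_comp_mul hr hr0 hr1 M R₁ c1
  have i2 := h.integrable_comp_mul hr hr0 hr1 M R₂ c2
  set x₀ := -(M * (R₁ + R₂) / (R₁ * R₂ + M ^ 2)) with hx₀
  set κ := r (sqDist M (max R₁ (min R₂ (-(M * x₀)))) x₀) with hκ
  have hmean : 0 ≤ ∫ ω, (crossTerm M R₂ (s ω) - crossTerm M R₁ (s ω)) ∂σ := by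
    rw [integral_sub c2 c1, h.integral_crossTerm hn hM hR1, h.integral_crossTerm hn hM hR2]
    have := h.monotoneOn_sub_mul_invMoment hn hM hR1 hR2 h12
    simp only at this
    linarith
  have hcmp : ∫ ω, κ * (crossTerm M R₂ (s ω) - crossTerm M R₁ (s ω)) ∂σ ≤
      ∫ ω, (r (sqDist M R₂ (s ω)) * crossTerm M R₂ (s ω) -
        r (sqDist M R₁ (s ω)) * crossTerm M R₁ (s ω)) ∂σ := by
    refine integral_mono_ae ((c2.sub c1).const_mul _) (i2.sub i1) ?_
    filter_upwards [h.ae_sqDist_pos hM hR1, h.ae_sqDist_pos hM hR2] with ω hT1 hT2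
    refine le_trans ?_ (le_sub_crossTerm hr hR1 h12 hT1 hT2)
    have hQ : 0 < R₁ * R₂ + M ^ 2 := by positivity
    have e : crossTerm M R₂ (s ω) - crossTerm M R₁ (s ω) =
        M * (R₂ - R₁) * (R₁ * R₂ + M ^ 2) * (s ω - x₀) /
          (sqDist M R₁ (s ω) * sqDist M R₂ (s ω)) := by
      have e1 : (R₁ * R₂ + M ^ 2) * (s ω - x₀) = M * (R₁ + R₂) + (R₁ * R₂ + M ^ 2) * s ω := by
        rw [hx₀]; field_simp; ring
      rw [mul_assoc (M * (R₂ - R₁)), e1]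
      unfold crossTerm
      field_simp
      unfold sqDist
      ring
    have hP : 0 ≤ M * (R₂ - R₁) * (R₁ * R₂ + M ^ 2) :=
      mul_nonneg (mul_nonneg hM (by linarith)) hQ.le
    rcases le_total x₀ (s ω) with hx | hx
    · refine mul_le_mul_of_nonneg_right (hr (sqDist_clamp_mono hM hR1 h12 hx)) ?_
      rw [e]
      exact div_nonneg (mul_nonneg hP (by linarith)) (by positivity)
    · refine mul_le_mul_of_nonpos_right (hr (sqDist_clamp_mono hM hR1 h12 hx)) ?_
      rw [e]
      exact div_nonpos_of_nonpos_of_nonneg (mul_nonpos_of_nonneg_of_nonpos hP (by linarith))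
        (by positivity)
  rw [integral_const_mul, integral_sub i2 i1] at hcmp
  have := mul_nonneg (hr0 (sqDist M (max R₁ (min R₂ (-(M * x₀)))) x₀)) hmean
  simp only
  linarith

end CrossTerm

/-! ### Coordinates of the uniform distribution on the sphere -/

section Sphere

open scoped Pointwise RealInnerProductSpace

variable {p : ℕ}

/-- The action of a linear isometry on the unit sphere. -/
noncomputable def sphereMap (O : Euc p ≃ₗᵢ[ℝ] Euc p) (θ : Metric.sphere (0 : Euc p) 1) :
    Metric.sphere (0 : Euc p) 1 :=
  ⟨O θ, by simp⟩

theorem measurePreserving_sphereMap (O : Euc p ≃ₗᵢ[ℝ] Euc p) :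
    MeasurePreserving (sphereMap O) (volume : Measure (Euc p)).toSphere
      (volume : Measure (Euc p)).toSphere := by
  have hm : Measurable (sphereMap O) :=
    (O.continuous.comp continuous_subtype_val).measurable.subtype_mk
  refine ⟨hm, Measure.ext fun s hs => ?_⟩
  rw [Measure.map_apply hm hs, Measure.toSphere_apply' _ (hm hs), Measure.toSphere_apply' _ hs]
  congr 1
  have e : Ioo (0 : ℝ) 1 • (Subtype.val '' (sphereMap O ⁻¹' s) : Set (Euc p)) =
      O.toMeasurableEquiv ⁻¹' (Ioo (0 : ℝ) 1 • (Subtype.val '' s)) := by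
    ext x
    simp only [Set.mem_smul, mem_image, mem_preimage, Subtype.exists, exists_and_right,
      exists_eq_right, LinearIsometryEquiv.coe_toMeasurableEquiv]
    constructor
    · rintro ⟨t, ht, y, ⟨hy, hys⟩, rfl⟩
      exact ⟨t, ht, O y, ⟨by simpa using hy, hys⟩, by simp⟩
    · rintro ⟨t, ht, y, ⟨hy, hys⟩, hx⟩
      refine ⟨t, ht, O.symm y, ⟨by simpa using hy, ?_⟩, ?_⟩
      · simpa [sphereMap] using hys
      · apply O.injective
        simp [hx]
  rw [e]
  exact O.measurePreserving.measure_preimage_equiv _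

theorem toSphere_inner_eq_neg_one (hp : 2 ≤ p) {u : Euc p} (hu : ‖u‖ = 1) :
    ∀ᵐ θ : Metric.sphere (0 : Euc p) 1 ∂(volume : Measure (Euc p)).toSphere,
      ⟪u, (θ : Euc p)⟫ ≠ -1 := by
  rw [ae_iff]
  have hm : MeasurableSet {θ : Metric.sphere (0 : Euc p) 1 | ¬ ⟪u, (θ : Euc p)⟫ ≠ -1} := by
    simp only [not_not]
    exact (measurableSet_singleton (-1 : ℝ)).preimage (by fun_prop)
  rw [Measure.toSphere_apply' _ hm]
  have hne : Submodule.span ℝ {u} ≠ ⊤ := by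
    intro h
    have h1 := finrank_span_le_card (R := ℝ) ({u} : Set (Euc p))
    rw [h] at h1
    simp at h1
    omega
  have h0 := Measure.addHaar_submodule (volume : Measure (Euc p)) _ hne
  refine mul_eq_zero_of_right _ (measure_mono_null ?_ h0)
  intro x hx
  obtain ⟨t, _, y, ⟨θ, hθ, rfl⟩, rfl⟩ := hx
  simp only [mem_ofPred_eq, not_not] at hθ
  have hθ1 : ‖(θ : Euc p)‖ = 1 := by simp
  have h2 := (inner_eq_one_iff_of_norm_eq_one (𝕜 := ℝ) hu (y := -(θ : Euc p)) (by simp)).1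
    (by rw [inner_neg_right, hθ, neg_neg])
  refine Submodule.smul_mem _ _ ?_
  rw [← neg_neg (θ : Euc p), ← h2]
  exact Submodule.neg_mem _ (Submodule.mem_span_singleton_self u)

theorem inner_sq_add_inner_sq_le {u v x : Euc p} (hu : ‖u‖ = 1) (hv : ‖v‖ = 1)
    (huv : ⟪u, v⟫ = 0) (hx : ‖x‖ = 1) : ⟪u, x⟫ ^ 2 + ⟪v, x⟫ ^ 2 ≤ 1 := by
  have h := real_inner_self_nonneg (x := x - ⟪u, x⟫ • u - ⟪v, x⟫ • v)
  simp only [inner_sub_left, inner_sub_right, inner_smul_left, inner_smul_right,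
    real_inner_self_eq_norm_sq, hu, hv, hx, huv, real_inner_comm u v, real_inner_comm u x,
    real_inner_comm v x] at h
  simp at h
  nlinarith

/-- The reflection that exchanges `u` and `cos φ u + sin φ v`. -/
theorem exists_isometry_inner_eq {u v : Euc p} (hu : ‖u‖ = 1) (hv : ‖v‖ = 1)
    (huv : ⟪u, v⟫ = 0) (φ : ℝ) : ∃ O : Euc p ≃ₗᵢ[ℝ] Euc p, ∀ x,
      ⟪u, O x⟫ = Real.cos φ * ⟪u, x⟫ + Real.sin φ * ⟪v, x⟫ ∧
      ⟪v, O x⟫ = Real.sin φ * ⟪u, x⟫ - Real.cos φ * ⟪v, x⟫ := by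
  set w : Euc p := Real.sin (φ / 2) • u - Real.cos (φ / 2) • v with hw
  have hcs := Real.sin_sq_add_cos_sq (φ / 2)
  have hvu : ⟪v, u⟫ = 0 := by rw [real_inner_comm]; exact huv
  have hwn : ‖w‖ ^ 2 = 1 := by
    rw [← real_inner_self_eq_norm_sq, hw]
    simp only [inner_sub_left, inner_sub_right, inner_smul_left, inner_smul_right,
      real_inner_self_eq_norm_sq, hu, hv, huv, hvu]
    simp
    nlinarith
  have hcos : Real.cos φ = 1 - 2 * Real.sin (φ / 2) ^ 2 := by
    have := Real.cos_two_mul' (φ / 2)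
    rw [mul_div_cancel₀ _ two_ne_zero] at this
    linarith
  have hsin : Real.sin φ = 2 * Real.sin (φ / 2) * Real.cos (φ / 2) := by
    have := Real.sin_two_mul (φ / 2)
    rwa [mul_div_cancel₀ _ two_ne_zero] at this
  refine ⟨(Submodule.span ℝ {w})ᗮ.reflection, fun x => ?_⟩
  have hO : (Submodule.span ℝ {w})ᗮ.reflection x = x - (2 * ⟪w, x⟫) • w := by
    rw [Submodule.reflection_orthogonal_apply, Submodule.reflection_singleton_apply]
    simp only [RCLike.ofReal_real_eq_id, id, hwn, div_one]
    module
  have hwx : ⟪w, x⟫ = Real.sin (φ / 2) * ⟪u, x⟫ - Real.cos (φ / 2) * ⟪v, x⟫ := by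
    rw [hw, inner_sub_left, inner_smul_left, inner_smul_left]; simp
  have huw : ⟪u, w⟫ = Real.sin (φ / 2) := by
    rw [hw, inner_sub_right, inner_smul_right, inner_smul_right, huv, real_inner_self_eq_norm_sq, hu]
    ring
  have hvw : ⟪v, w⟫ = -Real.cos (φ / 2) := by
    rw [hw, inner_sub_right, inner_smul_right, inner_smul_right, hvu, real_inner_self_eq_norm_sq, hv]
    ring
  rw [hO, inner_sub_right, inner_sub_right, inner_smul_right, inner_smul_right, huw, hvw, hwx,
    hcos, hsin]
  constructor
  · ring
  · linear_combination (-2 * ⟪v, x⟫) * hcs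

/-- Integration by parts on the sphere: by invariance under the reflections above, the integral of
`-⟨v, θ⟩ (K + b ⟨u, θ⟩)⁻¹` rotated by the angle `φ` in the plane of `u` and `v` does not depend on
`φ`, and its derivative at `φ = 0` vanishes. -/
theorem integral_toSphere_inner_mul_inv {u v : Euc p} (hu : ‖u‖ = 1) (hv : ‖v‖ = 1)
    (huv : ⟪u, v⟫ = 0) {K b : ℝ} (hb : |b| < K) :
    ∫ θ, ⟪u, (θ : Euc p)⟫ * (K + b * ⟪u, (θ : Euc p)⟫)⁻¹ ∂(volume : Measure (Euc p)).toSphere =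
      ∫ θ, ⟪v, (θ : Euc p)⟫ ^ 2 * (-b * ((K + b * ⟪u, (θ : Euc p)⟫) ^ 2)⁻¹)
        ∂(volume : Measure (Euc p)).toSphere := by
  set σ := (volume : Measure (Euc p)).toSphere with hσ
  set s : Metric.sphere (0 : Euc p) 1 → ℝ := fun θ => ⟪u, (θ : Euc p)⟫ with hs
  set t : Metric.sphere (0 : Euc p) 1 → ℝ := fun θ => ⟪v, (θ : Euc p)⟫ with ht
  have hsm : Continuous s := by fun_prop
  have htm : Continuous t := by fun_prop
  have hst : ∀ θ, s θ ^ 2 + t θ ^ 2 ≤ 1 := fun θ =>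
    inner_sq_add_inner_sq_le hu hv huv (by simp)
  set C : ℝ → Metric.sphere (0 : Euc p) 1 → ℝ :=
    fun φ θ => Real.cos φ * s θ + Real.sin φ * t θ with hC
  set S : ℝ → Metric.sphere (0 : Euc p) 1 → ℝ :=
    fun φ θ => Real.sin φ * s θ - Real.cos φ * t θ with hS
  have hCS : ∀ φ θ, C φ θ ^ 2 + S φ θ ^ 2 ≤ 1 := fun φ θ => by
    have : C φ θ ^ 2 + S φ θ ^ 2 = (s θ ^ 2 + t θ ^ 2) * (Real.sin φ ^ 2 + Real.cos φ ^ 2) := by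
      simp only [hC, hS]; ring
    rw [this, Real.sin_sq_add_cos_sq, mul_one]; exact hst θ
  have hC1 : ∀ φ θ, |C φ θ| ≤ 1 := fun φ θ =>
    abs_le_one_iff_mul_self_le_one.2 (by nlinarith [hCS φ θ, sq_nonneg (S φ θ)])
  have hS1 : ∀ φ θ, |S φ θ| ≤ 1 := fun φ θ =>
    abs_le_one_iff_mul_self_le_one.2 (by nlinarith [hCS φ θ, sq_nonneg (C φ θ)])
  have hT : ∀ φ θ, K - |b| ≤ K + b * C φ θ := fun φ θ => by
    have : |b * C φ θ| ≤ |b| := by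
      rw [abs_mul]; exact mul_le_of_le_one_right (abs_nonneg _) (hC1 φ θ)
    linarith [(abs_le.1 this).1]
  have hKb : 0 < K - |b| := by linarith
  have hd := hasDerivAt_integral_of_dominated_loc_of_deriv_le (μ := σ) (x₀ := 0)
    (s := univ) (F := fun φ θ => S φ θ * (K + b * C φ θ)⁻¹)
    (F' := fun φ θ => C φ θ * (K + b * C φ θ)⁻¹ +
      S φ θ * (-(b * -S φ θ) / (K + b * C φ θ) ^ 2))
    (bound := fun _ => 1 * (K - |b|)⁻¹ + 1 * (|b| * 1 / (K - |b|) ^ 2))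
    Filter.univ_mem
    (Filter.Eventually.of_forall fun φ =>
      Measurable.aestronglyMeasurable (by fun_prop))
    (Integrable.of_bound (C := 1 * (K - |b|)⁻¹)
      (Measurable.aestronglyMeasurable (by fun_prop))
      (Filter.Eventually.of_forall fun θ => by
        have := hT 0 θ
        rw [norm_mul, Real.norm_eq_abs, Real.norm_of_nonneg
          (inv_nonneg.2 (hKb.le.trans this))]
        exact mul_le_mul (hS1 0 θ) (inv_anti₀ hKb this) (inv_nonneg.2 (hKb.le.trans this))
          zero_le_one))
    (Measurable.aestronglyMeasurable (by fun_prop))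
    (Filter.Eventually.of_forall fun θ φ _ => by
      have h1 := hT φ θ
      have h2 : 0 < K + b * C φ θ := hKb.trans_le h1
      refine (norm_add_le _ _).trans (add_le_add ?_ ?_)
      · rw [norm_mul, Real.norm_eq_abs, Real.norm_of_nonneg (inv_nonneg.2 h2.le)]
        exact mul_le_mul (hC1 φ θ) (inv_anti₀ hKb h1) (inv_nonneg.2 h2.le) zero_le_one
      · rw [norm_mul, Real.norm_eq_abs, norm_div, Real.norm_eq_abs, Real.norm_eq_abs, abs_neg,
          abs_mul, abs_neg, abs_of_pos (show 0 < (K + b * C φ θ) ^ 2 by positivity)]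
        have := hS1 φ θ
        gcongr)
    (integrable_const _)
    (Filter.Eventually.of_forall fun θ φ _ => by
      have h2 : 0 < K + b * C φ θ := hKb.trans_le (hT φ θ)
      have dC : HasDerivAt (fun φ => C φ θ) (-S φ θ) φ := by
        have := ((Real.hasDerivAt_cos φ).mul_const (s θ)).add
          ((Real.hasDerivAt_sin φ).mul_const (t θ))
        refine this.congr_deriv ?_
        simp only [hS]; ring
      have dS : HasDerivAt (fun φ => S φ θ) (C φ θ) φ := by
        have := ((Real.hasDerivAt_sin φ).mul_const (s θ)).sub
          ((Real.hasDerivAt_cos φ).mul_const (t θ))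
        refine this.congr_deriv ?_
        simp only [hC]; ring
      exact dS.mul (((dC.const_mul b).const_add K).inv h2.ne'))
  have hconst : ∀ φ, ∫ θ, S φ θ * (K + b * C φ θ)⁻¹ ∂σ = ∫ θ, t θ * (K + b * s θ)⁻¹ ∂σ := by
    intro φ
    obtain ⟨O, hO⟩ := exists_isometry_inner_eq hu hv huv φ
    have hmap := (measurePreserving_sphereMap O).map_eq
    conv_rhs => rw [hσ, ← hmap]
    rw [integral_map (measurePreserving_sphereMap O).measurable.aemeasurable
      (Measurable.aestronglyMeasurable (by fun_prop))]
    refine integral_congr_ae (Filter.Eventually.of_forall fun θ => ?_)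
    simp only [hS, hC, hs, ht, sphereMap, (hO θ).1, (hO θ).2]
  have h0 := hd.2
  simp only [hconst] at h0
  have h1 := h0.unique (hasDerivAt_const (0 : ℝ) _)
  have hT0 : ∀ θ, K - |b| ≤ K + b * s θ := fun θ => by
    have := hT 0 θ
    simpa [hC] using this
  have hs1 : ∀ θ, |s θ| ≤ 1 := fun θ => by simpa [hC] using hC1 0 θ
  have ht1 : ∀ θ, |t θ| ≤ 1 := fun θ => by simpa [hS] using hS1 0 θ
  have j1 : Integrable (fun θ => s θ * (K + b * s θ)⁻¹) σ :=
    Integrable.of_bound (C := 1 * (K - |b|)⁻¹) (Measurable.aestronglyMeasurable (by fun_prop))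
      (Filter.Eventually.of_forall fun θ => by
        rw [norm_mul, Real.norm_eq_abs, Real.norm_of_nonneg
          (inv_nonneg.2 (hKb.le.trans (hT0 θ)))]
        exact mul_le_mul (hs1 θ) (inv_anti₀ hKb (hT0 θ)) (inv_nonneg.2 (hKb.le.trans (hT0 θ)))
          zero_le_one)
  have h2 : ∫ θ, (s θ * (K + b * s θ)⁻¹ - t θ ^ 2 * (-b * ((K + b * s θ) ^ 2)⁻¹)) ∂σ = 0 := by
    rw [← h1]
    refine integral_congr_ae (Filter.Eventually.of_forall fun θ => ?_)
    simp only [hC, hS, Real.cos_zero, Real.sin_zero]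
    ring
  have j2 : Integrable (fun θ => t θ ^ 2 * (-b * ((K + b * s θ) ^ 2)⁻¹)) σ :=
    Integrable.of_bound (C := 1 * (|b| * ((K - |b|) ^ 2)⁻¹))
      (Measurable.aestronglyMeasurable (by fun_prop))
      (Filter.Eventually.of_forall fun θ => by
        have h3 := hT0 θ
        have h4 : 0 < K + b * s θ := hKb.trans_le h3
        have h5 : 0 ≤ ((K + b * s θ) ^ 2)⁻¹ := by positivity
        rw [norm_mul, norm_mul, Real.norm_of_nonneg (sq_nonneg _), norm_neg, Real.norm_eq_abs,
          Real.norm_of_nonneg h5]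
        refine mul_le_mul (by nlinarith [hst θ, sq_nonneg (s θ)]) ?_ (by positivity) zero_le_one
        gcongr)
  rw [integral_sub j1 j2] at h2
  linarith

/-- The coordinate of the surface measure of the unit sphere along a unit vector `u`. -/
theorem isSphereCoordinate_toSphere (hp : 2 ≤ p) {u : Euc p} (hu : ‖u‖ = 1) :
    IsSphereCoordinate (volume : Measure (Euc p)).toSphere (p : ℝ)
      (fun θ => ⟪u, (θ : Euc p)⟫) where
  measurable := by fun_prop
  abs_le θ := by
    have := abs_real_inner_le_norm u (θ : Euc p)
    simpa [hu] using this
  ae_ne := toSphere_inner_eq_neg_one hp hu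
  parts K b hb := by
    have hp0 : 0 < p := by omega
    let i₀ : Fin p := ⟨0, hp0⟩
    obtain ⟨B, hB⟩ := Orthonormal.exists_orthonormalBasis_extension_of_card_eq (𝕜 := ℝ)
      (E := Euc p) (ι := Fin p) (by simp) (v := fun _ => u) (s := {i₀})
      (by
        rw [orthonormal_iff_ite]
        rintro ⟨i, hi⟩ ⟨j, hj⟩
        simp only [mem_singleton_iff] at hi hj
        subst hi hj
        simp [hu])
    have hB0 : B i₀ = u := hB i₀ rfl
    have hpair : ∀ j ∈ Finset.univ.erase i₀,
        ∫ θ, ⟪u, (θ : Euc p)⟫ * (K + b * ⟪u, (θ : Euc p)⟫)⁻¹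
          ∂(volume : Measure (Euc p)).toSphere =
        ∫ θ, ⟪B j, (θ : Euc p)⟫ ^ 2 * (-b * ((K + b * ⟪u, (θ : Euc p)⟫) ^ 2)⁻¹)
          ∂(volume : Measure (Euc p)).toSphere := fun j hj =>
      integral_toSphere_inner_mul_inv hu (B.orthonormal.1 j)
        (by rw [← hB0]; exact B.orthonormal.2 (Finset.ne_of_mem_erase hj).symm) hb
    have hsum := Finset.sum_congr rfl hpair
    rw [Finset.sum_const, Finset.card_erase_of_mem (Finset.mem_univ _), Finset.card_univ,
      Fintype.card_fin, nsmul_eq_mul, Nat.cast_sub (by omega), Nat.cast_one] at hsum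
    rw [hsum, ← integral_finsetSum]
    · refine integral_congr_ae (Filter.Eventually.of_forall fun θ => ?_)
      simp only
      rw [← Finset.sum_mul]
      congr 1
      have h1 := B.sum_sq_inner_right (θ : Euc p)
      rw [← Finset.add_sum_erase _ _ (Finset.mem_univ i₀), hB0] at h1
      have h2 : ‖(θ : Euc p)‖ = 1 := by simp
      rw [h2] at h1
      linarith
    · intro j _
      refine Continuous.integrable_of_hasCompactSupport ?_ (HasCompactSupport.of_compactSpace _)
      have hT : ∀ θ : Metric.sphere (0 : Euc p) 1, (K + b * ⟪u, (θ : Euc p)⟫) ^ 2 ≠ 0 := by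
        intro θ
        have h1 : |⟪u, (θ : Euc p)⟫| ≤ 1 := by
          have := abs_real_inner_le_norm u (θ : Euc p)
          simpa [hu] using this
        have : |b * ⟪u, (θ : Euc p)⟫| ≤ |b| := by
          rw [abs_mul]; exact mul_le_of_le_one_right (abs_nonneg _) h1
        have h2 := (abs_le.1 this).1
        have : 0 < K + b * ⟪u, (θ : Euc p)⟫ := by linarith
        positivity
      fun_prop (disch := exact hT _)

end Sphere

/-! ### The marginal density of the first coordinate -/

section Marginal

/-- The nonincreasing `[0, ∞]`-valued radial density that agrees with `q` on `(0, ∞)`; the value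
`∞` elsewhere makes it monotone on the whole line. -/
noncomputable def radialDensity (q : ℝ → ℝ) (u : ℝ) : ℝ≥0∞ :=
  if 0 < u then ENNReal.ofReal (q u) else ∞

theorem antitone_radialDensity {q : ℝ → ℝ} (hq : AntitoneOn q (Ioi 0)) :
    Antitone (radialDensity q) := by
  intro u v huv
  unfold radialDensity
  by_cases hu : 0 < u
  · rw [if_pos hu, if_pos (hu.trans_le huv)]
    exact ENNReal.ofReal_le_ofReal (hq hu (hu.trans_le huv) huv)
  · rw [if_neg hu]; exact le_top

/-- The first coordinate of a point and the vector of the remaining ones. -/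
noncomputable def splitFirst (n : ℕ) (y : Euc (n + 1)) : ℝ × Euc n :=
  (y 0, WithLp.toLp 2 fun i => y i.succ)

theorem measurePreserving_splitFirst (n : ℕ) :
    MeasurePreserving (splitFirst n) (volume : Measure (Euc (n + 1))) volume := by
  have h1 := PiLp.volume_preserving_ofLp (Fin (n + 1))
  have h2 := volume_preserving_piFinSuccAbove (fun _ : Fin (n + 1) => ℝ) 0
  have h3 : MeasurePreserving (Prod.map id (WithLp.toLp 2) : ℝ × (Fin n → ℝ) → ℝ × Euc n)
      volume volume :=
    (MeasurePreserving.id volume).prod (PiLp.volume_preserving_toLp (Fin n))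
  exact h3.comp (h2.comp h1)

theorem norm_sq_eq_splitFirst (n : ℕ) (y : Euc (n + 1)) :
    ‖y‖ ^ 2 = (splitFirst n y).1 ^ 2 + ‖(splitFirst n y).2‖ ^ 2 := by
  simp [EuclideanSpace.norm_sq_eq, Fin.sum_univ_succ, splitFirst]

/-- The density `s ↦ ∫ q(s² + ‖y‖²) dy` of the first coordinate, with values in `[0, ∞]`. -/
noncomputable def marginalLDensity (n : ℕ) (q : ℝ → ℝ) (s : ℝ) : ℝ≥0∞ :=
  ∫⁻ y : Euc n, radialDensity q (s ^ 2 + ‖y‖ ^ 2)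

/-- The density of the first coordinate. -/
noncomputable def marginalDensity (n : ℕ) (q : ℝ → ℝ) (s : ℝ) : ℝ :=
  (marginalLDensity n q s).toReal

variable {n : ℕ} {q : ℝ → ℝ}

theorem measurable_radialDensity (hq : AntitoneOn q (Ioi 0)) : Measurable (radialDensity q) :=
  (antitone_radialDensity hq).measurable

theorem measurable_marginalLDensity (hq : AntitoneOn q (Ioi 0)) :
    Measurable (marginalLDensity n q) := by
  have := measurable_radialDensity hq
  exact Measurable.lintegral_prod_right'
    (f := fun w : ℝ × Euc n => radialDensity q (w.1 ^ 2 + ‖w.2‖ ^ 2)) (by fun_prop)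

theorem radialDensity_ae_eq {p : ℕ} [NeZero p] (q : ℝ → ℝ) (m : Euc p) :
    (fun y : Euc p => ENNReal.ofReal (q (‖y - m‖ ^ 2))) =ᵐ[volume]
      fun y => radialDensity q (‖y - m‖ ^ 2) := by
  have : Nonempty (Fin p) := ⟨0⟩
  filter_upwards [compl_mem_ae_iff.2 (measure_singleton m)] with y hy
  have h0 : 0 < ‖y - m‖ ^ 2 := by
    have : y - m ≠ 0 := sub_ne_zero.2 hy
    positivity
  simp [radialDensity, h0]

theorem withDensity_eq_radialDensity {p : ℕ} [NeZero p] (q : ℝ → ℝ) :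
    (volume : Measure (Euc p)).withDensity (fun y => ENNReal.ofReal (q (‖y‖ ^ 2))) =
      volume.withDensity fun y => radialDensity q (‖y‖ ^ 2) :=
  withDensity_congr_ae (by simpa using radialDensity_ae_eq q (0 : Euc p))

theorem withDensity_first_mem (hq : AntitoneOn q (Ioi 0)) {B : Set ℝ} (hB : MeasurableSet B) :
    (volume : Measure (Euc (n + 1))).withDensity (fun y => ENNReal.ofReal (q (‖y‖ ^ 2)))
      {y | y 0 ∈ B} = ∫⁻ s in B, marginalLDensity n q s := by
  have hm := measurable_radialDensity hq
  have hmeas : Measurable fun w : ℝ × Euc n =>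
      B.indicator 1 w.1 * radialDensity q (w.1 ^ 2 + ‖w.2‖ ^ 2) := by
    have : Measurable (B.indicator (1 : ℝ → ℝ≥0∞)) := measurable_one.indicator hB
    fun_prop
  have hS : MeasurableSet {y : Euc (n + 1) | y 0 ∈ B} := hB.preimage (by fun_prop)
  rw [withDensity_eq_radialDensity, withDensity_apply _ hS, ← lintegral_indicator hS,
    ← lintegral_indicator hB]
  have h1 : ∀ y : Euc (n + 1), {y : Euc (n + 1) | y 0 ∈ B}.indicator
      (fun y => radialDensity q (‖y‖ ^ 2)) y =
      (fun w : ℝ × Euc n => B.indicator 1 w.1 * radialDensity q (w.1 ^ 2 + ‖w.2‖ ^ 2))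
        (splitFirst n y) := by
    intro y
    have e : (splitFirst n y).1 = y 0 := rfl
    by_cases hy : y 0 ∈ B
    · rw [indicator_of_mem (by exact hy)]
      simp only [e, indicator_of_mem hy, Pi.one_apply, one_mul]
      rw [norm_sq_eq_splitFirst, e]
    · rw [indicator_of_notMem (by exact hy)]
      simp only [e, indicator_of_notMem hy, zero_mul]
  rw [lintegral_congr h1, (measurePreserving_splitFirst n).lintegral_comp hmeas,
    Measure.volume_eq_prod, lintegral_prod _ hmeas.aemeasurable]
  refine lintegral_congr fun s => ?_
  dsimp only
  rw [lintegral_const_mul _ (by fun_prop)]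
  by_cases hs : s ∈ B <;> simp [hs, marginalLDensity]

theorem lintegral_marginalLDensity (hq : IsUnimodalSphericalDensity (n + 1) q) :
    ∫⁻ s, marginalLDensity n q s = 1 := by
  have := withDensity_first_mem (n := n) hq.unimodal MeasurableSet.univ
  rw [setLIntegral_univ] at this
  rw [← this, ← hq.lintegral_eq_one]
  simp

theorem marginalLDensity_anti (hq : AntitoneOn q (Ioi 0)) {s t : ℝ} (hs : 0 ≤ s) (hst : s ≤ t) :
    marginalLDensity n q t ≤ marginalLDensity n q s :=
  lintegral_mono fun y => antitone_radialDensity hq (by gcongr)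

/-- The marginal density is finite off the origin: otherwise it would be infinite on an interval,
by monotonicity, while its integral is `1`. -/
theorem marginalLDensity_ne_top (hq : IsUnimodalSphericalDensity (n + 1) q) {s : ℝ} (hs : 0 < s) :
    marginalLDensity n q s ≠ ∞ := by
  intro h
  have h1 : ∫⁻ _ in Ioo 0 s, ∞ ≤ ∫⁻ t, marginalLDensity n q t := by
    refine le_trans (setLIntegral_mono_ae (measurable_marginalLDensity hq.unimodal).aemeasurable
      (Filter.Eventually.of_forall fun t ht => ?_)) (setLIntegral_le_lintegral _ _)
    rw [← h]
    exact marginalLDensity_anti hq.unimodal ht.1.le ht.2.le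
  rw [lintegral_marginalLDensity hq, setLIntegral_const, Real.volume_Ioo, sub_zero,
    ENNReal.top_mul (by simpa using hs)] at h1
  simp at h1

theorem marginalLDensity_neg (s : ℝ) : marginalLDensity n q (-s) = marginalLDensity n q s := by
  simp [marginalLDensity]

theorem ofReal_marginalDensity_ae (hq : IsUnimodalSphericalDensity (n + 1) q) :
    ∀ᵐ s, ENNReal.ofReal (marginalDensity n q s) = marginalLDensity n q s := by
  filter_upwards [compl_mem_ae_iff.2 (measure_singleton (0 : ℝ))] with s hs
  refine ENNReal.ofReal_toReal ?_
  rcases lt_or_gt_of_ne (show s ≠ 0 from hs) with h | h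
  · rw [← neg_neg s, marginalLDensity_neg]
    exact marginalLDensity_ne_top hq (by linarith)
  · exact marginalLDensity_ne_top hq h

theorem integrable_marginalDensity (hq : IsUnimodalSphericalDensity (n + 1) q) :
    Integrable (marginalDensity n q) :=
  integrable_toReal_of_lintegral_ne_top (measurable_marginalLDensity hq.unimodal).aemeasurable
    (by rw [lintegral_marginalLDensity hq]; exact ENNReal.one_ne_top)

theorem marginalDensity_nonneg (s : ℝ) : 0 ≤ marginalDensity n q s := ENNReal.toReal_nonneg

theorem setIntegral_marginalDensity (hq : IsUnimodalSphericalDensity (n + 1) q) {B : Set ℝ} :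
    ∫ s in B, marginalDensity n q s = (∫⁻ s in B, marginalLDensity n q s).toReal := by
  rw [integral_eq_lintegral_of_nonneg_ae
    (Filter.Eventually.of_forall fun s => marginalDensity_nonneg s)
    (integrable_marginalDensity hq).aestronglyMeasurable.restrict]
  congr 1
  exact lintegral_congr_ae (ae_restrict_of_ae (ofReal_marginalDensity_ae hq))

theorem marginalCdf_eq_integral (hq : IsUnimodalSphericalDensity (n + 1) q) (t : ℝ) :
    marginalCdf (n + 1) q t = ∫ s in Iic t, marginalDensity n q s := by
  rw [setIntegral_marginalDensity hq, ← withDensity_first_mem hq.unimodal measurableSet_Iic]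
  rfl

theorem antitoneOn_marginalDensity (hq : IsUnimodalSphericalDensity (n + 1) q) :
    AntitoneOn (marginalDensity n q) (Ioi 0) := fun _ hs _ _ hst =>
  ENNReal.toReal_mono (marginalLDensity_ne_top hq hs)
    (marginalLDensity_anti hq.unimodal (le_of_lt hs) hst)

/-- The marginal density is continuous off the origin: `q` has countably many jumps, each of
which is met on a sphere, a null set of the remaining coordinates. -/
theorem continuousAt_marginalDensity (hn : 1 ≤ n) (hq : IsUnimodalSphericalDensity (n + 1) q)
    {s : ℝ} (hs : 0 < s) : ContinuousAt (marginalDensity n q) s := by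
  have hm := measurable_radialDensity hq.unimodal
  have hanti := antitone_radialDensity hq.unimodal
  have : Nontrivial (Euc n) := by
    have : Nonempty (Fin n) := ⟨⟨0, hn⟩⟩
    infer_instance
  refine (ENNReal.tendsto_toReal (marginalLDensity_ne_top hq hs)).comp ?_
  refine tendsto_lintegral_filter_of_dominated_convergence
    (fun y : Euc n => radialDensity q ((s / 2) ^ 2 + ‖y‖ ^ 2))
    (Filter.Eventually.of_forall fun t => by fun_prop) ?_
    (marginalLDensity_ne_top hq (half_pos hs)) ?_
  · filter_upwards [lt_mem_nhds (half_lt_self hs)] with t ht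
    refine Filter.Eventually.of_forall fun y => hanti ?_
    gcongr
  · have hc : {u : ℝ | ¬ContinuousAt (radialDensity q) u}.Countable :=
      hanti.countable_not_continuousAt
    have hnull : volume (⋃ u ∈ {u : ℝ | ¬ContinuousAt (radialDensity q) u},
        {y : Euc n | s ^ 2 + ‖y‖ ^ 2 = u}) = 0 := by
      rw [measure_biUnion_null_iff hc]
      intro u _
      refine measure_mono_null ?_ (Measure.addHaar_sphere volume (0 : Euc n) (Real.sqrt (u - s ^ 2)))
      intro y hy
      have hy : s ^ 2 + ‖y‖ ^ 2 = u := hy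
      rw [mem_sphere_zero_iff_norm, ← hy, add_sub_cancel_left, Real.sqrt_sq (norm_nonneg y)]
    filter_upwards [compl_mem_ae_iff.2 hnull] with y hy
    have hcy : ContinuousAt (radialDensity q) (s ^ 2 + ‖y‖ ^ 2) := by
      by_contra hcon
      exact hy (mem_biUnion (show (s ^ 2 + ‖y‖ ^ 2) ∈ {u : ℝ | ¬ContinuousAt (radialDensity q) u}
        from hcon) rfl)
    have : ContinuousAt (fun t : ℝ => t ^ 2 + ‖y‖ ^ 2) s := by fun_prop
    exact ContinuousAt.comp (f := fun t : ℝ => t ^ 2 + ‖y‖ ^ 2) hcy this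

theorem marginalCdf_sub (hq : IsUnimodalSphericalDensity (n + 1) q) (a b : ℝ) :
    marginalCdf (n + 1) q b - marginalCdf (n + 1) q a = ∫ s in a..b, marginalDensity n q s := by
  rw [marginalCdf_eq_integral hq, marginalCdf_eq_integral hq]
  exact intervalIntegral.integral_Iic_sub_Iic (integrable_marginalDensity hq).integrableOn
    (integrable_marginalDensity hq).integrableOn

theorem hasDerivAt_marginalCdf (hn : 1 ≤ n) (hq : IsUnimodalSphericalDensity (n + 1) q)
    {t : ℝ} (ht : 0 < t) : HasDerivAt (marginalCdf (n + 1) q) (marginalDensity n q t) t := by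
  have h := (intervalIntegral.integral_hasDerivAt_right (a := 0) (b := t)
    (integrable_marginalDensity hq).intervalIntegrable
    ((integrable_marginalDensity hq).aestronglyMeasurable.stronglyMeasurableAtFilter)
    (continuousAt_marginalDensity hn hq ht)).add_const (marginalCdf (n + 1) q 0)
  refine h.congr_of_eventuallyEq (Filter.Eventually.of_forall fun x => ?_)
  simp only
  rw [← marginalCdf_sub hq]
  ring

theorem marginalCdf_neg (hq : IsUnimodalSphericalDensity (n + 1) q) (t : ℝ) :
    marginalCdf (n + 1) q (-t) = 1 - marginalCdf (n + 1) q t := by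
  have hi := integrable_marginalDensity hq
  have h1 : ∫ s, marginalDensity n q s = 1 := by
    have := setIntegral_marginalDensity hq (B := univ)
    rw [setIntegral_univ, setLIntegral_univ, lintegral_marginalLDensity hq] at this
    simpa using this
  have h2 := integral_add_compl (measurableSet_Iic (a := t)) hi
  rw [compl_Iic] at h2
  have h3 := integral_comp_neg_Iic (-t) (marginalDensity n q)
  have h4 : ∀ s, marginalDensity n q (-s) = marginalDensity n q s := fun s => by
    simp [marginalDensity, marginalLDensity_neg]
  simp only [h4, neg_neg] at h3
  rw [marginalCdf_eq_integral hq, marginalCdf_eq_integral hq, h3]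
  linarith

end Marginal

section Cdf

variable {p : ℕ} [NeZero p] {q : ℝ → ℝ}

theorem deriv_marginalCdf_nonneg (hp : 2 ≤ p) (hq : IsUnimodalSphericalDensity p q) {t : ℝ}
    (ht : 0 < t) : 0 ≤ deriv (marginalCdf p q) t := by
  obtain ⟨n, rfl⟩ : ∃ n, p = n + 1 := ⟨p - 1, by omega⟩
  rw [(hasDerivAt_marginalCdf (by omega) hq ht).deriv]
  exact marginalDensity_nonneg t

/-- The cdf of the first coordinate lies below its tangents on `[0, ∞)`. -/
theorem marginalCdf_sub_le (hp : 2 ≤ p) (hq : IsUnimodalSphericalDensity p q) {a b : ℝ}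
    (ha : 0 < a) (hb : 0 ≤ b) :
    marginalCdf p q b - marginalCdf p q a ≤ deriv (marginalCdf p q) a * (b - a) := by
  obtain ⟨n, rfl⟩ : ∃ n, p = n + 1 := ⟨p - 1, by omega⟩
  rw [(hasDerivAt_marginalCdf (by omega) hq ha).deriv]
  have hi := integrable_marginalDensity hq
  rcases le_total a b with h | h
  · have h1 := intervalIntegral.integral_mono_on_of_le_Ioo h hi.intervalIntegrable
      (intervalIntegrable_const (c := marginalDensity n q a))
      fun x hx => antitoneOn_marginalDensity hq ha (ha.trans hx.1) hx.1.le
    rw [intervalIntegral.integral_const, smul_eq_mul, mul_comm] at h1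
    exact (marginalCdf_sub hq a b).trans_le h1
  · have h1 := intervalIntegral.integral_mono_on_of_le_Ioo h
      (intervalIntegrable_const (c := marginalDensity n q a)) hi.intervalIntegrable
      fun x hx => antitoneOn_marginalDensity hq (hb.trans_lt hx.1) ha hx.2.le
    rw [intervalIntegral.integral_const, smul_eq_mul] at h1
    have h2 := marginalCdf_sub hq b a
    have h3 : marginalCdf (n + 1) q a - marginalCdf (n + 1) q b ≥ (a - b) * marginalDensity n q a :=
      h1.trans_eq h2.symm
    linarith

theorem marginalCdf_neg_eq (hq : IsUnimodalSphericalDensity p q) (t : ℝ) :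
    marginalCdf p q (-t) = 1 - marginalCdf p q t := by
  obtain ⟨n, rfl⟩ : ∃ n, p = n + 1 := ⟨p - 1, by have := NeZero.ne p; omega⟩
  exact marginalCdf_neg hq t

end Cdf

/-! ### The loss as a concave function of the squared distance -/

section Loss

variable {p : ℕ} [NeZero p] {q : ℝ → ℝ}

/-- The `L₁` distance between `q(‖· - μ‖²)` and `q(‖· - m‖²)` when `‖m - μ‖ = d`. -/
noncomputable def l1Dist (p : ℕ) [NeZero p] (q : ℝ → ℝ) (d : ℝ) : ℝ :=
  2 * (marginalCdf p q (d / 2) - marginalCdf p q (-(d / 2)))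

omit [NeZero p] in
theorem isProbabilityMeasure_radial (hq : IsUnimodalSphericalDensity p q) :
    IsProbabilityMeasure ((volume : Measure (Euc p)).withDensity
      fun y => ENNReal.ofReal (q (‖y‖ ^ 2))) :=
  ⟨by rw [withDensity_apply _ MeasurableSet.univ, setLIntegral_univ, hq.lintegral_eq_one]⟩

theorem setLIntegral_first_le (hq : IsUnimodalSphericalDensity p q) (t : ℝ) :
    ∫⁻ y in {y : Euc p | y 0 ≤ t}, ENNReal.ofReal (q (‖y‖ ^ 2)) =
      ENNReal.ofReal (marginalCdf p q t) := by
  have := isProbabilityMeasure_radial hq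
  have hS : MeasurableSet {y : Euc p | y 0 ≤ t} :=
    measurableSet_le (by fun_prop) measurable_const
  rw [marginalCdf, ofReal_measureReal, withDensity_apply _ hS]

theorem monotone_marginalCdf (hq : IsUnimodalSphericalDensity p q) : Monotone (marginalCdf p q) := by
  have := isProbabilityMeasure_radial hq
  intro a b hab
  exact measureReal_mono fun y (hy : y 0 ≤ a) => le_trans hy hab

theorem marginalCdf_mem (hq : IsUnimodalSphericalDensity p q) (t : ℝ) :
    0 ≤ marginalCdf p q t ∧ marginalCdf p q t ≤ 1 := by
  have := isProbabilityMeasure_radial hq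
  exact ⟨measureReal_nonneg, measureReal_le_one⟩

theorem setLIntegral_lt_first (hq : IsUnimodalSphericalDensity p q) (t : ℝ) :
    ∫⁻ y in {y : Euc p | y 0 ≤ t}ᶜ, ENNReal.ofReal (q (‖y‖ ^ 2)) =
      ENNReal.ofReal (1 - marginalCdf p q t) := by
  have := isProbabilityMeasure_radial hq
  have hS : MeasurableSet {y : Euc p | y 0 ≤ t} :=
    measurableSet_le (by fun_prop) measurable_const
  rw [← withDensity_apply _ hS.compl, ← ofReal_measureReal, measureReal_compl hS]
  simp [marginalCdf]

/-- The two densities are compared on the half-space of the points closer to the first centre, and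
on its complement. -/
theorem lintegral_abs_sub_shift (hq : IsUnimodalSphericalDensity p q) {d : ℝ} (hd : 0 ≤ d) :
    ∫⁻ y : Euc p, ENNReal.ofReal |q (‖y‖ ^ 2) - q (‖y - EuclideanSpace.single 0 d‖ ^ 2)| =
      ENNReal.ofReal (l1Dist p q d) := by
  have : Nonempty (Fin p) := ⟨0⟩
  set m : Euc p := EuclideanSpace.single 0 d with hm
  set A : Set (Euc p) := {y | y 0 ≤ d / 2} with hA
  have hAm : MeasurableSet A := measurableSet_le (by fun_prop) measurable_const
  have hrm := measurable_radialDensity hq.unimodal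
  have m1 : AEMeasurable (fun y : Euc p => ENNReal.ofReal (q (‖y‖ ^ 2))) volume := by
    have h := radialDensity_ae_eq q (0 : Euc p)
    simp only [sub_zero] at h
    exact AEMeasurable.congr (by fun_prop) h.symm
  have m2 : AEMeasurable (fun y : Euc p => ENNReal.ofReal (q (‖y - m‖ ^ 2))) volume :=
    AEMeasurable.congr (by fun_prop) (radialDensity_ae_eq q m).symm
  have hnorm : ∀ y : Euc p, ‖y - m‖ ^ 2 = ‖y‖ ^ 2 + d * (d - 2 * y 0) := by
    intro y
    rw [norm_sub_sq_real, hm]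
    simp [EuclideanSpace.inner_single_right]
    ring
  have hae : ∀ᵐ y : Euc p, y ≠ 0 ∧ y ≠ m := by
    filter_upwards [compl_mem_ae_iff.2 (measure_singleton (0 : Euc p)),
      compl_mem_ae_iff.2 (measure_singleton m)] with y h1 h2
    exact ⟨h1, h2⟩
  have hpos : ∀ y : Euc p, y ≠ 0 ∧ y ≠ m → 0 < ‖y‖ ^ 2 ∧ 0 < ‖y - m‖ ^ 2 := fun y hy => by
    have h1 := norm_pos_iff.2 hy.1
    have h2 := norm_pos_iff.2 (sub_ne_zero.2 hy.2)
    exact ⟨by positivity, by positivity⟩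
  have shift : ∀ S : Set (Euc p), MeasurableSet S →
      ∫⁻ y in S, ENNReal.ofReal (q (‖y - m‖ ^ 2)) =
        ∫⁻ y in (fun y => y + m) ⁻¹' S, ENNReal.ofReal (q (‖y‖ ^ 2)) := by
    intro S hS
    have hmp := measurePreserving_add_right (volume : Measure (Euc p)) m
    rw [← (hmp.setLIntegral_comp_preimage_emb (MeasurableEquiv.addRight m).measurableEmbedding
      (fun y => ENNReal.ofReal (q (‖y - m‖ ^ 2))) S)]
    simp
  have hpre : (fun y => y + m) ⁻¹' A = {y : Euc p | y 0 ≤ -(d / 2)} := by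
    ext y
    simp only [hA, hm, mem_preimage, mem_ofPred_eq, PiLp.add_apply, PiLp.single_apply,
      if_pos]
    constructor <;> intro h <;> linarith
  have i2A : ∫⁻ y in A, ENNReal.ofReal (q (‖y - m‖ ^ 2)) =
      ENNReal.ofReal (marginalCdf p q (-(d / 2))) := by
    rw [shift A hAm, hpre, setLIntegral_first_le hq]
  have i2B : ∫⁻ y in Aᶜ, ENNReal.ofReal (q (‖y - m‖ ^ 2)) =
      ENNReal.ofReal (1 - marginalCdf p q (-(d / 2))) := by
    rw [shift Aᶜ hAm.compl, preimage_compl, hpre, setLIntegral_lt_first hq]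
  have hF := monotone_marginalCdf hq (show -(d / 2) ≤ d / 2 by linarith)
  have hA1 : ∫⁻ y in A, ENNReal.ofReal |q (‖y‖ ^ 2) - q (‖y - m‖ ^ 2)| =
      ENNReal.ofReal (marginalCdf p q (d / 2) - marginalCdf p q (-(d / 2))) := by
    have hle : ∀ y ∈ A, y ≠ 0 ∧ y ≠ m → 0 ≤ q (‖y - m‖ ^ 2) ∧ q (‖y - m‖ ^ 2) ≤ q (‖y‖ ^ 2) := by
      intro y hy hne
      obtain ⟨h1, h2⟩ := hpos y hne
      refine ⟨hq.nonneg _ h2, hq.unimodal h1 h2 ?_⟩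
      have hy : y 0 ≤ d / 2 := hy
      rw [hnorm]
      nlinarith
    rw [ENNReal.ofReal_sub _ (marginalCdf_mem hq _).1, ← i2A, ← setLIntegral_first_le hq,
      ← lintegral_sub' m2.restrict (by rw [i2A]; exact ENNReal.ofReal_ne_top)]
    · refine setLIntegral_congr_fun_ae hAm ?_
      filter_upwards [hae] with y hne hy
      obtain ⟨h1, h2⟩ := hle y hy hne
      rw [abs_of_nonneg (by linarith), ENNReal.ofReal_sub _ h1]
    · refine (ae_restrict_iff' hAm).2 ?_
      filter_upwards [hae] with y hne hy
      exact ENNReal.ofReal_le_ofReal (hle y hy hne).2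
  have hB1 : ∫⁻ y in Aᶜ, ENNReal.ofReal |q (‖y‖ ^ 2) - q (‖y - m‖ ^ 2)| =
      ENNReal.ofReal (marginalCdf p q (d / 2) - marginalCdf p q (-(d / 2))) := by
    have hle : ∀ y ∈ Aᶜ, y ≠ 0 ∧ y ≠ m → 0 ≤ q (‖y‖ ^ 2) ∧ q (‖y‖ ^ 2) ≤ q (‖y - m‖ ^ 2) := by
      intro y hy hne
      obtain ⟨h1, h2⟩ := hpos y hne
      refine ⟨hq.nonneg _ h1, hq.unimodal h2 h1 ?_⟩
      have hy : d / 2 < y 0 := not_le.1 hy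
      rw [hnorm]
      nlinarith
    have e : marginalCdf p q (d / 2) - marginalCdf p q (-(d / 2)) =
        (1 - marginalCdf p q (-(d / 2))) - (1 - marginalCdf p q (d / 2)) := by ring
    have i1B := setLIntegral_lt_first hq (d / 2)
    rw [e, ENNReal.ofReal_sub _ (by linarith [(marginalCdf_mem hq (d / 2)).2]), ← i2B, ← i1B,
      ← lintegral_sub' m1.restrict (by rw [i1B]; exact ENNReal.ofReal_ne_top)]
    · refine setLIntegral_congr_fun_ae hAm.compl ?_
      filter_upwards [hae] with y hne hy
      obtain ⟨h1, h2⟩ := hle y hy hne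
      rw [abs_sub_comm, abs_of_nonneg (by linarith), ENNReal.ofReal_sub _ h1]
    · refine (ae_restrict_iff' hAm.compl).2 ?_
      filter_upwards [hae] with y hne hy
      exact ENNReal.ofReal_le_ofReal (hle y hy hne).2
  rw [← lintegral_add_compl _ hAm, hA1, hB1, ← ENNReal.ofReal_add (by linarith) (by linarith),
    l1Dist]
  congr 1
  ring

/-- The loss of a plug-in estimator depends only on the distance of the plugged-in point to `μ`. -/
theorem l1Loss_plugIn (hq : IsUnimodalSphericalDensity p q) (δ : Euc p → Euc p) (μ x : Euc p) :
    l1Loss q μ (plugIn q δ x) = ENNReal.ofReal (l1Dist p q ‖δ x - μ‖) := by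
  set d := ‖δ x - μ‖ with hd
  have hd0 : 0 ≤ d := norm_nonneg _
  set e : Euc p := EuclideanSpace.single 0 d with he
  have hnorm : ‖e‖ = ‖δ x - μ‖ := by rw [he]; simp [hd]
  set O := (Submodule.span ℝ {e - (δ x - μ)})ᗮ.reflection with hO
  have hOe : O e = δ x - μ := Submodule.reflection_sub hnorm
  rw [← lintegral_abs_sub_shift hq hd0, l1Loss]
  have hmp : MeasurePreserving (fun y : Euc p => O y + μ) volume volume :=
    (measurePreserving_add_right (volume : Measure (Euc p)) μ).comp O.measurePreserving
  have hemb : MeasurableEmbedding (fun y : Euc p => O y + μ) :=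
    (MeasurableEquiv.addRight μ).measurableEmbedding.comp O.toMeasurableEquiv.measurableEmbedding
  rw [← hmp.lintegral_comp_emb hemb]
  refine lintegral_congr fun y => ?_
  have h1 : ‖O y + μ - μ‖ = ‖y‖ := by rw [add_sub_cancel_right, O.norm_map]
  have h2 : ‖O y + μ - δ x‖ = ‖y - e‖ := by
    rw [← O.norm_map (y - e), map_sub, hOe]
    congr 1
    abel
  simp only [plugIn, h1, h2, he]

theorem monotone_l1Dist (hq : IsUnimodalSphericalDensity p q) : Monotone (l1Dist p q) := by
  intro a b hab
  have h1 := monotone_marginalCdf hq (show a / 2 ≤ b / 2 by linarith)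
  have h2 := monotone_marginalCdf hq (show -(b / 2) ≤ -(a / 2) by linarith)
  unfold l1Dist
  linarith

theorem abs_l1Dist_le (hq : IsUnimodalSphericalDensity p q) (d : ℝ) : |l1Dist p q d| ≤ 2 := by
  have h1 := marginalCdf_mem hq (d / 2)
  have h2 := marginalCdf_mem hq (-(d / 2))
  unfold l1Dist
  rw [abs_le]
  constructor <;> linarith

theorem l1Dist_nonneg (hq : IsUnimodalSphericalDensity p q) {d : ℝ} (hd : 0 ≤ d) :
    0 ≤ l1Dist p q d := by
  have h1 := monotone_marginalCdf hq (show -(d / 2) ≤ d / 2 by linarith)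
  unfold l1Dist
  linarith

/-- The weight `F'(d/2) / d`, the derivative of the loss with respect to the squared distance. -/
noncomputable def lossSlope (p : ℕ) [NeZero p] (q : ℝ → ℝ) (d : ℝ) : ℝ :=
  deriv (marginalCdf p q) (d / 2) / d

theorem lossSlope_nonneg (hp : 2 ≤ p) (hq : IsUnimodalSphericalDensity p q) {d : ℝ} (hd : 0 ≤ d) :
    0 ≤ lossSlope p q d := by
  rcases hd.eq_or_lt with rfl | h
  · simp [lossSlope]
  · exact div_nonneg (deriv_marginalCdf_nonneg hp hq (by linarith)) hd

/-- The concavity inequality for the loss as a function of the squared distance. The last term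
measures how far the tangent in the distance lies below the tangent in the squared distance. -/
theorem l1Dist_sub_le (hp : 2 ≤ p) (hq : IsUnimodalSphericalDensity p q) {d e : ℝ} (hd : 0 < d)
    (he : 0 ≤ e) :
    l1Dist p q e - l1Dist p q d ≤
      lossSlope p q d * (e ^ 2 - d ^ 2) - lossSlope p q d * (e - d) ^ 2 := by
  have h1 := marginalCdf_sub_le hp hq (show 0 < d / 2 by linarith) (show 0 ≤ e / 2 by linarith)
  have h2 : lossSlope p q d * (e ^ 2 - d ^ 2) - lossSlope p q d * (e - d) ^ 2 =
      2 * deriv (marginalCdf p q) (d / 2) * (e - d) := by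
    unfold lossSlope
    field_simp
    ring
  rw [h2]
  unfold l1Dist
  rw [marginalCdf_neg_eq hq, marginalCdf_neg_eq hq]
  linarith

end Loss

/-! ### Reduction to the radius -/

section Radial

/-- A correlation inequality on the half-line. If `A` is nondecreasing and dominates `κ u B(u)`,
then comparing `A` with its value at the point where `u⁻¹` equals its mean `m` gives
`κ ∫ B ≤ ∫ A u⁻¹ ≤ m ∫ A`. -/
theorem mul_integral_le_of_monotoneOn {τ : Measure ℝ} [IsFiniteMeasure τ]
    (hτ : ∀ᵐ u ∂τ, 0 < u) (hτ0 : τ ≠ 0) (hinv : Integrable (fun u : ℝ => u⁻¹) τ)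
    {A B : ℝ → ℝ} (hA : Integrable A τ) (hB : Integrable B τ) (hmono : MonotoneOn A (Ioi 0))
    {C κ a : ℝ} (hC : ∀ u, 0 < u → |A u| ≤ C) (hκ : 0 < κ) (hB0 : ∀ u, 0 < u → 0 ≤ B u)
    (hBA : ∀ u, 0 < u → κ * u * B u ≤ A u)
    (ha : a * ∫ u, u⁻¹ ∂τ ≤ 2 * κ * τ.real univ) :
    a * ∫ u, B u ∂τ ≤ 2 * ∫ u, A u ∂τ := by
  have hτ1 : 0 < τ.real univ := by
    rw [measureReal_def]
    exact ENNReal.toReal_pos (by simpa using hτ0) (measure_ne_top _ _)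
  have hI : 0 < ∫ u, u⁻¹ ∂τ := by
    rw [integral_pos_iff_support_of_nonneg_ae (by
      filter_upwards [hτ] with u hu using inv_nonneg.2 hu.le) hinv]
    refine lt_of_lt_of_le (pos_iff_ne_zero.2 (by simpa using hτ0 : τ univ ≠ 0))
      (measure_mono_ae ?_)
    filter_upwards [hτ] with u hu _
    exact inv_ne_zero hu.ne'
  set m := (∫ u, u⁻¹ ∂τ) / τ.real univ with hm
  have hm0 : 0 < m := div_pos hI hτ1
  have hAinv : Integrable (fun u => A u * u⁻¹) τ :=
    hinv.bdd_mul (c := C) hA.aestronglyMeasurable (by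
      filter_upwards [hτ] with u hu using hC u hu)
  have hi1 : Integrable (fun u => u⁻¹ - m) τ := hinv.sub (integrable_const _)
  have hz : ∫ u, (u⁻¹ - m) ∂τ = 0 := by
    rw [integral_sub hinv (integrable_const _), integral_const, smul_eq_mul, hm]
    field_simp
    ring
  have h1 : ∫ u, (A u * u⁻¹ - m * A u) ∂τ ≤ ∫ u, A m⁻¹ * (u⁻¹ - m) ∂τ := by
    refine integral_mono_ae (hAinv.sub (hA.const_mul _)) (hi1.const_mul _) ?_
    filter_upwards [hτ] with u hu
    have hcase : (A u - A m⁻¹) * (u⁻¹ - m) ≤ 0 := by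
      rcases le_total u m⁻¹ with h | h
      · refine mul_nonpos_of_nonpos_of_nonneg
          (sub_nonpos.2 (hmono hu (show (0 : ℝ) < m⁻¹ by positivity) h)) (sub_nonneg.2 ?_)
        rw [le_inv_comm₀ hm0 hu]; exact h
      · refine mul_nonpos_of_nonneg_of_nonpos
          (sub_nonneg.2 (hmono (show (0 : ℝ) < m⁻¹ by positivity) hu h)) (sub_nonpos.2 ?_)
        rw [inv_le_comm₀ hu hm0]; exact h
    linarith
  rw [integral_const_mul, hz, mul_zero, integral_sub hAinv (hA.const_mul _),
    integral_const_mul] at h1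
  have h2 : κ * ∫ u, B u ∂τ ≤ ∫ u, A u * u⁻¹ ∂τ := by
    rw [← integral_const_mul]
    refine integral_mono_ae (hB.const_mul _) hAinv ?_
    filter_upwards [hτ] with u hu
    have := mul_le_mul_of_nonneg_right (hBA u hu) (inv_nonneg.2 hu.le)
    refine le_trans (le_of_eq ?_) this
    field_simp
  have h3 : 0 ≤ ∫ u, A u ∂τ := integral_nonneg_of_ae (by
    filter_upwards [hτ] with u hu
    exact le_trans (mul_nonneg (mul_nonneg hκ.le hu.le) (hB0 u hu)) (hBA u hu))
  have h4 : 0 ≤ ∫ u, B u ∂τ := integral_nonneg_of_ae (by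
    filter_upwards [hτ] with u hu using hB0 u hu)
  have h5 : a * m ≤ 2 * κ := by
    rw [hm, ← mul_div_assoc, div_le_iff₀ hτ1]; exact ha
  rcases le_total a 0 with ha0 | ha0
  · exact (mul_nonpos_of_nonpos_of_nonneg ha0 h4).trans (by positivity)
  · have h6 : κ * (a * ∫ u, B u ∂τ) ≤ κ * (2 * ∫ u, A u ∂τ) := by
      calc κ * (a * ∫ u, B u ∂τ) = a * (κ * ∫ u, B u ∂τ) := by ring
        _ ≤ a * (m * ∫ u, A u ∂τ) := by
          refine mul_le_mul_of_nonneg_left ?_ ha0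
          linarith
        _ = (a * m) * ∫ u, A u ∂τ := by ring
        _ ≤ 2 * κ * ∫ u, A u ∂τ := mul_le_mul_of_nonneg_right h5 h3
        _ = κ * (2 * ∫ u, A u ∂τ) := by ring
    exact le_of_mul_le_mul_left h6 hκ

variable {p : ℕ} [NeZero p] {ν : Measure ℝ} {pX q : ℝ → ℝ}

/-- The law of the squared radius of the noise, weighted by the slope of the loss and divided by
the surface measure of the sphere. -/
noncomputable def weightedRadialLaw (p : ℕ) [NeZero p] (ν : Measure ℝ) (pX q : ℝ → ℝ) : Measure ℝ :=
  ((ν.restrict (Ioi 0)).withDensity fun u => ENNReal.ofReal (u ^ ((p : ℝ) / 2 - 1) / 2)).withDensity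
    fun u => ENNReal.ofReal (pX u) * ENNReal.ofReal (lossSlope p q (Real.sqrt u))

/-- The law of the noise, weighted by the slope of the loss. -/
noncomputable def weightedNoiseLaw (p : ℕ) [NeZero p] (ν : Measure ℝ) (pX q : ℝ → ℝ) :
    Measure (Euc p) :=
  (noiseLaw p ν pX).withDensity fun z => ENNReal.ofReal (lossSlope p q ‖z‖)

theorem measurable_lossSlope : Measurable (lossSlope p q) :=
  ((measurable_deriv (marginalCdf p q)).comp (by fun_prop)).div measurable_id

theorem weightedRadialLaw_pos : ∀ᵐ u ∂(weightedRadialLaw p ν pX q), 0 < u :=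
  (withDensity_absolutelyContinuous _ _).ae_le
    ((withDensity_absolutelyContinuous _ _).ae_le (ae_restrict_mem measurableSet_Ioi))

/-- Polar coordinates `(u, θ) ↦ √u θ`. -/
noncomputable def polarPoint (p : ℕ) (w : ℝ × Metric.sphere (0 : Euc p) 1) : Euc p :=
  Real.sqrt w.1 • (w.2 : Euc p)

omit [NeZero p] in
theorem measurable_polarPoint : Measurable (polarPoint p) := by
  unfold polarPoint
  fun_prop

omit [NeZero p] in
theorem norm_polarPoint (w : ℝ × Metric.sphere (0 : Euc p) 1) :
    ‖polarPoint p w‖ = Real.sqrt w.1 := by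
  simp [polarPoint, norm_smul, abs_of_nonneg (Real.sqrt_nonneg _)]

/-- The weighted law of the noise in polar coordinates. -/
theorem weightedNoiseLaw_eq_map (hpX : Measurable pX) :
    weightedNoiseLaw p ν pX q =
      ((weightedRadialLaw p ν pX q).prod (volume : Measure (Euc p)).toSphere).map
        (polarPoint p) := by
  have hs := measurable_lossSlope (p := p) (q := q)
  have hm1 : Measurable fun z : Euc p => ENNReal.ofReal (pX (‖z‖ ^ 2)) := by fun_prop
  have hm2 : Measurable fun z : Euc p => ENNReal.ofReal (lossSlope p q ‖z‖) := by fun_prop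
  have hm3 : Measurable fun u =>
      ENNReal.ofReal (pX u) * ENNReal.ofReal (lossSlope p q (Real.sqrt u)) := by
    fun_prop
  set base := (ν.restrict (Ioi 0)).withDensity
    fun u => ENNReal.ofReal (u ^ ((p : ℝ) / 2 - 1) / 2) with hbase
  have hpos : ∀ᵐ u ∂base, 0 < u :=
    (withDensity_absolutelyContinuous _ _).ae_le (ae_restrict_mem measurableSet_Ioi)
  have hΦ := measurable_polarPoint (p := p)
  refine Measure.ext_of_lintegral _ fun f hf => ?_
  rw [weightedNoiseLaw, lintegral_withDensity_eq_lintegral_mul _ hm2 hf, noiseLaw,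
    lintegral_withDensity_eq_lintegral_mul _ hm1 (hm2.mul hf), lintegral_map hf hΦ]
  have e1 : sphericalMeasure p ν =
      (base.prod (volume : Measure (Euc p)).toSphere).map (polarPoint p) := rfl
  have e2 : weightedRadialLaw p ν pX q = base.withDensity fun u =>
    ENNReal.ofReal (pX u) * ENNReal.ofReal (lossSlope p q (Real.sqrt u)) := rfl
  rw [e1, lintegral_map (hm1.mul (hm2.mul hf)) hΦ, e2, prod_withDensity_left hm3,
    lintegral_withDensity_eq_lintegral_mul _
      (show Measurable fun z : ℝ × Metric.sphere (0 : Euc p) 1 => ENNReal.ofReal (pX z.1) *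
        ENNReal.ofReal (lossSlope p q (Real.sqrt z.1)) from hm3.comp measurable_fst)
      (show Measurable fun w => f (polarPoint p w) from hf.comp hΦ)]
  refine lintegral_congr_ae ?_
  filter_upwards [Measure.quasiMeasurePreserving_fst.ae hpos] with w hw
  simp only [Pi.mul_apply, norm_polarPoint, Real.sq_sqrt hw.le]
  ring

theorem weightedNoiseLaw_univ (hpX : Measurable pX) : weightedNoiseLaw p ν pX q univ =
    weightedRadialLaw p ν pX q univ * (volume : Measure (Euc p)).toSphere univ := by
  rw [weightedNoiseLaw_eq_map hpX, Measure.map_apply measurable_polarPoint MeasurableSet.univ,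
    preimage_univ, ← univ_prod_univ, Measure.prod_prod]

theorem radialIntegral_eq (hpX : Measurable pX) (hpX0 : ∀ u, 0 < u → 0 ≤ pX u) (k : ℝ) :
    radialIntegral p ν pX q (((p : ℝ) - 3) / 2 - k) =
      2 * ∫⁻ u, ENNReal.ofReal (u ^ (-k)) ∂(weightedRadialLaw p ν pX q) := by
  have hs := measurable_lossSlope (p := p) (q := q)
  rw [weightedRadialLaw, lintegral_withDensity_eq_lintegral_mul _ (by fun_prop) (by fun_prop),
    lintegral_withDensity_eq_lintegral_mul _ (by fun_prop) (by fun_prop),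
    ← lintegral_const_mul _ (by fun_prop), radialIntegral]
  refine setLIntegral_congr_fun measurableSet_Ioi fun u hu => ?_
  have hu : 0 < u := hu
  have h0 := hpX0 u hu
  have hsq : 0 < Real.sqrt u := Real.sqrt_pos.2 hu
  simp only [Pi.mul_apply]
  rw [← ENNReal.ofReal_mul h0, mul_comm (ENNReal.ofReal (pX u * _)),
    ← ENNReal.ofReal_mul (by positivity), ← ENNReal.ofReal_mul (by positivity),
    show (2 : ℝ≥0∞) = ENNReal.ofReal 2 by simp, ← ENNReal.ofReal_mul (by norm_num)]
  congr 1
  have e : u ^ (((p : ℝ) - 3) / 2 - k) = u ^ ((p : ℝ) / 2 - 1) * u ^ (-k) / Real.sqrt u := by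
    rw [Real.sqrt_eq_rpow, ← Real.rpow_add hu, ← Real.rpow_sub hu]
    congr 1
    ring
  rw [e, lossSlope]
  field_simp

end Radial

/-! ### The weighted quadratic risk difference -/

section WeightedRisk

variable {Ω : Type*} [MeasurableSpace Ω] {σ : Measure Ω} {n : ℝ} {s : Ω → ℝ} [IsFiniteMeasure σ]
  {τ : Measure ℝ}

omit [IsFiniteMeasure σ] in
theorem IsSphereCoordinate.measurable_sqDist_sqrt (h : IsSphereCoordinate σ n s) (M : ℝ) :
    Measurable fun w : ℝ × Ω => sqDist M (Real.sqrt w.1) (s w.2) := by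
  have := h.measurable
  unfold sqDist
  fun_prop

omit [IsFiniteMeasure σ] in
theorem IsSphereCoordinate.measurable_crossTerm_sqrt (h : IsSphereCoordinate σ n s) (M : ℝ) :
    Measurable fun w : ℝ × Ω => crossTerm M (Real.sqrt w.1) (s w.2) := by
  have := h.measurable_sqDist_sqrt M
  unfold crossTerm
  fun_prop

theorem IsSphereCoordinate.integrable_prod_inv (h : IsSphereCoordinate σ n s) (hn : 4 ≤ n)
    (hτ : ∀ᵐ u ∂τ, 0 < u) (hinv : Integrable (fun u : ℝ => u⁻¹) τ) {M : ℝ} (hM : 0 ≤ M) :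
    Integrable (fun w : ℝ × Ω => (sqDist M (Real.sqrt w.1) (s w.2))⁻¹) (τ.prod σ) := by
  have hm : AEStronglyMeasurable (fun w : ℝ × Ω => (sqDist M (Real.sqrt w.1) (s w.2))⁻¹)
    (τ.prod σ) := (h.measurable_sqDist_sqrt M).inv.aestronglyMeasurable
  rw [integrable_prod_iff hm]
  refine ⟨?_, ?_⟩
  · filter_upwards [hτ] with u hu
    exact h.integrable_inv_sqDist hn hM (Real.sqrt_pos.2 hu)
  · refine (hinv.const_mul (σ.real univ)).mono' hm.norm.integral_prod_right' ?_
    filter_upwards [hτ] with u hu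
    have hR := Real.sqrt_pos.2 hu
    have h1 := (h.invMoment_mul_le hn hM hR).2
    rw [Real.sq_sqrt hu.le] at h1
    rw [Real.norm_of_nonneg (integral_nonneg fun _ => norm_nonneg _), ← div_eq_mul_inv,
      le_div_iff₀ hu]
    refine le_trans (le_of_eq ?_) h1
    congr 1
    exact integral_congr_ae (Filter.Eventually.of_forall fun ω =>
      Real.norm_of_nonneg (inv_nonneg.2 (sqDist_nonneg hM hR.le (h.abs_le ω))))

theorem IsSphereCoordinate.integral_abs_crossTerm_le (h : IsSphereCoordinate σ n s) (hn : 4 ≤ n)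
    {M R : ℝ} (hM : 0 ≤ M) (hR : 0 < R) :
    ∫ ω, |crossTerm M R (s ω)| ∂σ ≤ 2 * σ.real univ := by
  have hi := h.integrable_inv_sqDist hn hM hR
  have hb := h.invMoment_mul_le hn hM hR
  have he := invMoment_nonneg h hM hR.le
  have hc0 : 0 ≤ 1 - 4 / n := by rw [sub_nonneg, div_le_one (by linarith)]; exact hn
  have h1 : ∫ ω, |crossTerm M R (s ω)| ∂σ ≤
      ∫ ω, (1 / 2 + (R ^ 2 + M ^ 2) / 2 * (sqDist M R (s ω))⁻¹) ∂σ := by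
    refine integral_mono (h.integrable_crossTerm hn hM hR).abs
      ((integrable_const _).add (hi.const_mul _)) fun ω => ?_
    have hT := inv_nonneg.2 (sqDist_nonneg hM hR.le (h.abs_le ω))
    unfold crossTerm
    refine (abs_add_le _ _).trans (add_le_add (by norm_num) ?_)
    rw [abs_mul, abs_of_nonneg hT]
    refine mul_le_mul_of_nonneg_right ?_ hT
    rw [_root_.abs_le]
    constructor <;> nlinarith [sq_nonneg R, sq_nonneg M]
  rw [integral_add (integrable_const _) (hi.const_mul _), integral_const_mul, integral_const,
    smul_eq_mul] at h1
  change _ ≤ _ + _ * invMoment σ s M R at h1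
  have h2 : 0 ≤ (1 - 4 / n) * R ^ 2 * invMoment σ s M R := by positivity
  have h3 : 0 ≤ σ.real univ := measureReal_nonneg
  nlinarith [hb.1, hb.2]

theorem IsSphereCoordinate.integrable_prod_crossTerm [IsFiniteMeasure τ]
    (h : IsSphereCoordinate σ n s) (hn : 4 ≤ n)
    (hτ : ∀ᵐ u ∂τ, 0 < u) {M : ℝ} (hM : 0 ≤ M) :
    Integrable (fun w : ℝ × Ω => crossTerm M (Real.sqrt w.1) (s w.2)) (τ.prod σ) := by
  have hm : AEStronglyMeasurable (fun w : ℝ × Ω => crossTerm M (Real.sqrt w.1) (s w.2))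
    (τ.prod σ) := (h.measurable_crossTerm_sqrt M).aestronglyMeasurable
  rw [integrable_prod_iff hm]
  refine ⟨?_, ?_⟩
  · filter_upwards [hτ] with u hu
    exact h.integrable_crossTerm hn hM (Real.sqrt_pos.2 hu)
  · refine Integrable.of_bound (C := 2 * σ.real univ) hm.norm.integral_prod_right' ?_
    filter_upwards [hτ] with u hu
    rw [Real.norm_of_nonneg (integral_nonneg fun _ => norm_nonneg _)]
    exact h.integral_abs_crossTerm_le hn hM (Real.sqrt_pos.2 hu)

variable {r : ℝ → ℝ}

omit [IsFiniteMeasure σ] in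
theorem IsSphereCoordinate.integrable_prod_comp_mul (h : IsSphereCoordinate σ n s)
    (hr : Monotone r) (hr0 : ∀ t, 0 ≤ r t) (hr1 : ∀ t, r t ≤ 1) (M : ℝ) {g : ℝ × Ω → ℝ}
    (hg : Integrable g (τ.prod σ)) :
    Integrable (fun w => r (sqDist M (Real.sqrt w.1) (s w.2)) * g w) (τ.prod σ) :=
  hg.bdd_mul (c := 1) (hr.measurable.comp (h.measurable_sqDist_sqrt M)).aestronglyMeasurable
    (Filter.Eventually.of_forall fun w => by
      rw [Real.norm_of_nonneg (hr0 _)]; exact hr1 _)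

/-- The quadratic risk of the shrinkage estimator under the weighted law does not exceed that of
the unshrunk one. -/
theorem IsSphereCoordinate.mul_integral_prod_le [IsFiniteMeasure τ]
    (h : IsSphereCoordinate σ n s) (hn : 4 ≤ n)
    (hτ : ∀ᵐ u ∂τ, 0 < u) (hτ0 : τ ≠ 0) (hinv : Integrable (fun u : ℝ => u⁻¹) τ)
    (hr : Monotone r) (hr0 : ∀ t, 0 ≤ r t) (hr1 : ∀ t, r t ≤ 1) {a : ℝ}
    (ha : a * ∫ u, u⁻¹ ∂τ ≤ 2 * ((n - 2) / n) * τ.real univ) {M : ℝ} (hM : 0 ≤ M) :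
    a * ∫ w : ℝ × Ω, r (sqDist M (Real.sqrt w.1) (s w.2)) *
        (sqDist M (Real.sqrt w.1) (s w.2))⁻¹ ∂(τ.prod σ) ≤
      2 * ∫ w : ℝ × Ω, r (sqDist M (Real.sqrt w.1) (s w.2)) *
        crossTerm M (Real.sqrt w.1) (s w.2) ∂(τ.prod σ) := by
  have i1 := h.integrable_prod_comp_mul hr hr0 hr1 M (h.integrable_prod_inv hn hτ hinv hM)
  have i2 := h.integrable_prod_comp_mul hr hr0 hr1 M (h.integrable_prod_crossTerm hn hτ hM)
  rw [integral_prod _ i1, integral_prod _ i2]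
  refine mul_integral_le_of_monotoneOn hτ hτ0 hinv
    (A := fun u => ∫ ω, r (sqDist M (Real.sqrt u) (s ω)) * crossTerm M (Real.sqrt u) (s ω) ∂σ)
    (B := fun u => ∫ ω, r (sqDist M (Real.sqrt u) (s ω)) * (sqDist M (Real.sqrt u) (s ω))⁻¹ ∂σ)
    i2.integral_prod_left i1.integral_prod_left (C := 2 * σ.real univ) (κ := (n - 2) / n) ?_ ?_
    (div_pos (by linarith) (by linarith)) ?_ ?_ ha
  · intro u hu v hv huv
    exact h.monotoneOn_integral_crossTerm hn hr hr0 hr1 hM (Real.sqrt_pos.2 hu)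
      (Real.sqrt_pos.2 hv) (Real.sqrt_le_sqrt huv)
  · intro u hu
    have hR := Real.sqrt_pos.2 hu
    refine (abs_integral_le_integral_abs).trans
      (le_trans ?_ (h.integral_abs_crossTerm_le hn hM hR))
    have hc := h.integrable_crossTerm hn hM hR
    refine integral_mono (h.integrable_comp_mul hr hr0 hr1 M _ hc).abs hc.abs fun ω => ?_
    simp only [abs_mul, abs_of_nonneg (hr0 _)]
    exact mul_le_of_le_one_left (abs_nonneg _) (hr1 _)
  · intro u hu
    exact integral_nonneg fun ω => mul_nonneg (hr0 _)
      (inv_nonneg.2 (sqDist_nonneg hM (Real.sqrt_nonneg u) (h.abs_le ω)))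
  · intro u hu
    have := h.mul_integral_inv_le_integral_crossTerm hn hr hr0 hr1 hM (Real.sqrt_pos.2 hu)
    rwa [Real.sq_sqrt hu.le] at this

end WeightedRisk

section Hypotheses

variable {p : ℕ} [NeZero p] {ν : Measure ℝ} {pX q : ℝ → ℝ}

theorem toSphere_univ_ne_zero : (volume : Measure (Euc p)).toSphere univ ≠ 0 := by
  have : Nonempty (Fin p) := ⟨0⟩
  rw [Measure.measure_univ_ne_zero]
  exact Measure.toSphere_ne_zero _

theorem isFiniteMeasure_weightedRadialLaw (hpX : Measurable pX)
    (h_fin : weightedNoiseLaw p ν pX q univ < ∞) :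
    IsFiniteMeasure (weightedRadialLaw p ν pX q) := by
  refine ⟨lt_of_not_ge fun h => ?_⟩
  rw [weightedNoiseLaw_univ hpX, top_le_iff.1 h, ENNReal.top_mul toSphere_univ_ne_zero] at h_fin
  exact lt_irrefl _ h_fin

/-- The bound on `a` in terms of the weighted radial law, with the integrability of `u⁻¹` that it
contains. -/
theorem integrable_inv_and_mul_le (hp : 4 ≤ p) (hpX : Measurable pX)
    (hpX0 : ∀ u, 0 < u → 0 ≤ pX u) [IsFiniteMeasure (weightedRadialLaw p ν pX q)]
    (hτ0 : weightedRadialLaw p ν pX q ≠ 0) {a : ℝ} (ha : 0 < a)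
    (ha_le : ENNReal.ofReal a ≤ ENNReal.ofReal (2 * ((p : ℝ) - 2) / p) *
      (radialIntegral p ν pX q (((p : ℝ) - 3) / 2) /
        radialIntegral p ν pX q (((p : ℝ) - 5) / 2))) :
    Integrable (fun u : ℝ => u⁻¹) (weightedRadialLaw p ν pX q) ∧
      a * ∫ u, u⁻¹ ∂(weightedRadialLaw p ν pX q) ≤
        2 * (((p : ℝ) - 2) / p) * (weightedRadialLaw p ν pX q).real univ := by
  set τ := weightedRadialLaw p ν pX q with hτdef
  have hpos : ∀ᵐ u ∂τ, 0 < u := weightedRadialLaw_pos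
  have e0 : radialIntegral p ν pX q (((p : ℝ) - 3) / 2) = 2 * τ univ := by
    have := radialIntegral_eq (p := p) (ν := ν) (q := q) hpX hpX0 0
    simpa using this
  have e1 : radialIntegral p ν pX q (((p : ℝ) - 5) / 2) = 2 * ∫⁻ u, ENNReal.ofReal u⁻¹ ∂τ := by
    have := radialIntegral_eq (p := p) (ν := ν) (q := q) hpX hpX0 1
    rw [show ((p : ℝ) - 3) / 2 - 1 = ((p : ℝ) - 5) / 2 by ring] at this
    simpa [Real.rpow_neg_one] using this
  rw [e0, e1, ENNReal.mul_div_mul_left _ _ two_ne_zero ENNReal.ofNat_ne_top] at ha_le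
  have hD0 : ∫⁻ u, ENNReal.ofReal u⁻¹ ∂τ ≠ 0 := by
    intro h
    rw [lintegral_eq_zero_iff (by fun_prop)] at h
    have : ∀ᵐ u ∂τ, False := by
      filter_upwards [h, hpos] with u h1 h2
      simp only [Pi.zero_apply, ENNReal.ofReal_eq_zero] at h1
      exact absurd (inv_pos.2 h2) (not_lt.2 h1)
    exact hτ0 (by simpa using this)
  have hDt : ∫⁻ u, ENNReal.ofReal u⁻¹ ∂τ ≠ ∞ := by
    intro h
    rw [h, ENNReal.div_top, mul_zero] at ha_le
    have := ENNReal.ofReal_eq_zero.1 (le_antisymm ha_le zero_le)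
    linarith
  have hi : Integrable (fun u : ℝ => u⁻¹) τ := by
    refine ⟨by fun_prop, ?_⟩
    rw [hasFiniteIntegral_iff_ofReal (by filter_upwards [hpos] with u hu using inv_nonneg.2 hu.le)]
    exact lt_top_iff_ne_top.2 hDt
  refine ⟨hi, ?_⟩
  have hp0 : (0 : ℝ) < p := by have : 0 < p := by omega
                               exact_mod_cast this
  have hp4 : (4 : ℝ) ≤ p := by exact_mod_cast hp
  have hDr : ∫⁻ u, ENNReal.ofReal u⁻¹ ∂τ = ENNReal.ofReal (∫ u, u⁻¹ ∂τ) :=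
    (ofReal_integral_eq_lintegral_ofReal hi
      (by filter_upwards [hpos] with u hu using inv_nonneg.2 hu.le)).symm
  rw [← mul_div_assoc, ENNReal.le_div_iff_mul_le (Or.inl hD0) (Or.inl hDt), hDr,
    ← ENNReal.ofReal_mul ha.le, ← ofReal_measureReal (μ := τ) (s := univ),
    ← ENNReal.ofReal_mul (div_nonneg (by linarith) hp0.le),
    ENNReal.ofReal_le_ofReal_iff
      (mul_nonneg (div_nonneg (by linarith) hp0.le) measureReal_nonneg)] at ha_le
  calc _ ≤ _ := ha_le
    _ = _ := by ring

end Hypotheses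

/-! ### Comparison of the risks -/

section Domination

open scoped RealInnerProductSpace

variable {p : ℕ}

theorem norm_sq_baranchik_sub (a : ℝ) (r : ℝ → ℝ) (z μ : Euc p) :
    ‖baranchik a r (z + μ) - μ‖ ^ 2 - ‖z‖ ^ 2 =
      a ^ 2 * (r (‖z + μ‖ ^ 2) ^ 2 * (‖z + μ‖ ^ 2)⁻¹) -
        2 * a * (r (‖z + μ‖ ^ 2) * (⟪z, z + μ⟫ * (‖z + μ‖ ^ 2)⁻¹)) := by
  set x := z + μ with hx
  have e : baranchik a r x - μ = z - (a * r (‖x‖ ^ 2) / ‖x‖ ^ 2) • x := by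
    have : μ = x - z := by rw [hx]; abel
    rw [baranchik, this]
    module
  rw [e, norm_sub_sq_real, norm_smul, mul_pow, Real.norm_eq_abs, sq_abs, inner_smul_right]
  rcases eq_or_ne x 0 with h | h
  · simp [h]
  · have : ‖x‖ ≠ 0 := norm_ne_zero_iff.2 h
    field_simp
    ring

/-- The change of the distance to `μ` is at most the length of the shrinkage step. -/
theorem sq_norm_sub_norm_le (a : ℝ) (r : ℝ → ℝ) (z μ : Euc p) :
    (‖baranchik a r (z + μ) - μ‖ - ‖z‖) ^ 2 ≤
      a ^ 2 * (r (‖z + μ‖ ^ 2) ^ 2 * (‖z + μ‖ ^ 2)⁻¹) := by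
  set x := z + μ with hx
  have e : baranchik a r x - μ - z = -((a * r (‖x‖ ^ 2) / ‖x‖ ^ 2) • x) := by
    have : μ = x - z := by rw [hx]; abel
    rw [baranchik, this]
    module
  have h1 := abs_norm_sub_norm_le (baranchik a r x - μ) z
  have h2 : (‖baranchik a r x - μ‖ - ‖z‖) ^ 2 ≤ ‖baranchik a r x - μ - z‖ ^ 2 := by
    rw [← sq_abs]
    exact pow_le_pow_left₀ (abs_nonneg _) h1 2
  refine h2.trans (le_of_eq ?_)
  rw [e, norm_neg, norm_smul, mul_pow, Real.norm_eq_abs, sq_abs]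
  rcases eq_or_ne x 0 with h | h
  · simp [h]
  · have : ‖x‖ ≠ 0 := norm_ne_zero_iff.2 h
    field_simp

theorem norm_sq_polarPoint_add {u₀ : Euc p} (hu : ‖u₀‖ = 1) (M : ℝ)
    (w : ℝ × Metric.sphere (0 : Euc p) 1) :
    ‖polarPoint p w + M • u₀‖ ^ 2 = sqDist M (Real.sqrt w.1) ⟪u₀, (w.2 : Euc p)⟫ := by
  rw [norm_add_sq_real, norm_polarPoint, norm_smul, hu, polarPoint, inner_smul_left,
    inner_smul_right, real_inner_comm, sqDist, mul_one, Real.norm_eq_abs, sq_abs]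
  simp
  ring

/-- In polar coordinates the inner product of the noise with the observation is the cross term;
at a vanishing observation both sides are `0` because `r` vanishes at `0`. -/
theorem mul_inner_polarPoint {u₀ : Euc p} (hu : ‖u₀‖ = 1) (M : ℝ) {r : ℝ → ℝ} (hr : r 0 = 0)
    (w : ℝ × Metric.sphere (0 : Euc p) 1) :
    r (‖polarPoint p w + M • u₀‖ ^ 2) * (⟪polarPoint p w, polarPoint p w + M • u₀⟫ *
        (‖polarPoint p w + M • u₀‖ ^ 2)⁻¹) =
      r (sqDist M (Real.sqrt w.1) ⟪u₀, (w.2 : Euc p)⟫) *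
        crossTerm M (Real.sqrt w.1) ⟪u₀, (w.2 : Euc p)⟫ := by
  have h1 := norm_sq_polarPoint_add hu M w
  have h2 : ⟪polarPoint p w, polarPoint p w + M • u₀⟫ =
      (‖polarPoint p w + M • u₀‖ ^ 2 + Real.sqrt w.1 ^ 2 - M ^ 2) / 2 := by
    rw [norm_add_sq_real, inner_add_right, real_inner_self_eq_norm_sq, norm_polarPoint, norm_smul,
      hu, mul_one, Real.norm_eq_abs, sq_abs]
    ring
  rw [h2, h1]
  rcases eq_or_ne (sqDist M (Real.sqrt w.1) ⟪u₀, (w.2 : Euc p)⟫) 0 with h | h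
  · rw [h, hr]; simp
  · unfold crossTerm
    field_simp
    ring

variable [NeZero p] {ν : Measure ℝ} {pX q r : ℝ → ℝ}

/-- Under the weighted law of the noise, the squared length of the shrinkage step and the cross term
are integrable, and the first is outweighed by the second. -/
theorem weighted_quadratic_bound (hp : 4 ≤ p) (hpX : Measurable pX)
    [IsFiniteMeasure (weightedRadialLaw p ν pX q)] (hτ0 : weightedRadialLaw p ν pX q ≠ 0)
    (hinv : Integrable (fun u : ℝ => u⁻¹) (weightedRadialLaw p ν pX q)) {a : ℝ} (ha0 : 0 ≤ a)
    (ha : a * ∫ u, u⁻¹ ∂(weightedRadialLaw p ν pX q) ≤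
        2 * (((p : ℝ) - 2) / p) * (weightedRadialLaw p ν pX q).real univ)
    (hr : Monotone r) (hr0 : ∀ t, 0 ≤ r t) (hr1 : ∀ t, r t ≤ 1) (hrz : r 0 = 0) (μ : Euc p) :
    Integrable (fun z => r (‖z + μ‖ ^ 2) ^ 2 * (‖z + μ‖ ^ 2)⁻¹) (weightedNoiseLaw p ν pX q) ∧
    Integrable (fun z => r (‖z + μ‖ ^ 2) * (⟪z, z + μ⟫ * (‖z + μ‖ ^ 2)⁻¹))
      (weightedNoiseLaw p ν pX q) ∧
    a * ∫ z, r (‖z + μ‖ ^ 2) ^ 2 * (‖z + μ‖ ^ 2)⁻¹ ∂(weightedNoiseLaw p ν pX q) ≤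
      2 * ∫ z, r (‖z + μ‖ ^ 2) * (⟪z, z + μ⟫ * (‖z + μ‖ ^ 2)⁻¹) ∂(weightedNoiseLaw p ν pX q) := by
  obtain ⟨M, u₀, hM, hu, rfl⟩ : ∃ (M : ℝ) (u₀ : Euc p), 0 ≤ M ∧ ‖u₀‖ = 1 ∧ M • u₀ = μ := by
    rcases eq_or_ne μ 0 with rfl | h
    · exact ⟨0, EuclideanSpace.single 0 1, le_rfl, by simp, by simp⟩
    · exact ⟨‖μ‖, ‖μ‖⁻¹ • μ, norm_nonneg _, norm_smul_inv_norm (𝕜 := ℝ) h,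
        smul_inv_smul₀ (norm_ne_zero_iff.2 h) μ⟩
  have hn : (4 : ℝ) ≤ p := by exact_mod_cast hp
  have h := isSphereCoordinate_toSphere (by omega : 2 ≤ p) hu
  have hpos : ∀ᵐ u ∂(weightedRadialLaw p ν pX q), 0 < u := weightedRadialLaw_pos
  have hrm := hr.measurable
  have hΦ := measurable_polarPoint (p := p)
  set π := (weightedRadialLaw p ν pX q).prod (volume : Measure (Euc p)).toSphere with hπ
  have hcmp := h.mul_integral_prod_le hn hpos hτ0 hinv hr hr0 hr1 ha hM
  have i1 := h.integrable_prod_comp_mul hr hr0 hr1 M (h.integrable_prod_inv hn hpos hinv hM)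
  have i2 := h.integrable_prod_comp_mul hr hr0 hr1 M
    (h.integrable_prod_crossTerm (τ := weightedRadialLaw p ν pX q) hn hpos hM)
  have i3 : Integrable (fun w : ℝ × Metric.sphere (0 : Euc p) 1 =>
      r (sqDist M (Real.sqrt w.1) ⟪u₀, (w.2 : Euc p)⟫) ^ 2 *
        (sqDist M (Real.sqrt w.1) ⟪u₀, (w.2 : Euc p)⟫)⁻¹) π := by
    refine (h.integrable_prod_comp_mul hr hr0 hr1 M i1).congr
      (Filter.Eventually.of_forall fun w => ?_)
    simp only
    ring
  have hle : ∫ w : ℝ × Metric.sphere (0 : Euc p) 1,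
      r (sqDist M (Real.sqrt w.1) ⟪u₀, (w.2 : Euc p)⟫) ^ 2 *
        (sqDist M (Real.sqrt w.1) ⟪u₀, (w.2 : Euc p)⟫)⁻¹ ∂π ≤
      ∫ w : ℝ × Metric.sphere (0 : Euc p) 1, r (sqDist M (Real.sqrt w.1) ⟪u₀, (w.2 : Euc p)⟫) *
        (sqDist M (Real.sqrt w.1) ⟪u₀, (w.2 : Euc p)⟫)⁻¹ ∂π := by
    refine integral_mono i3 i1 fun w => ?_
    refine mul_le_mul_of_nonneg_right ?_
      (inv_nonneg.2 (sqDist_nonneg hM (Real.sqrt_nonneg _) (h.abs_le w.2)))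
    nlinarith [hr0 (sqDist M (Real.sqrt w.1) ⟪u₀, (w.2 : Euc p)⟫),
      hr1 (sqDist M (Real.sqrt w.1) ⟪u₀, (w.2 : Euc p)⟫)]
  have m1 : Measurable fun z : Euc p => r (‖z + M • u₀‖ ^ 2) ^ 2 * (‖z + M • u₀‖ ^ 2)⁻¹ := by
    fun_prop
  have m2 : Measurable fun z : Euc p =>
      r (‖z + M • u₀‖ ^ 2) * (⟪z, z + M • u₀⟫ * (‖z + M • u₀‖ ^ 2)⁻¹) := by
    fun_prop
  rw [weightedNoiseLaw_eq_map hpX, integrable_map_measure m1.aestronglyMeasurable hΦ.aemeasurable,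
    integrable_map_measure m2.aestronglyMeasurable hΦ.aemeasurable,
    integral_map hΦ.aemeasurable m1.aestronglyMeasurable,
    integral_map hΦ.aemeasurable m2.aestronglyMeasurable]
  simp only [Function.comp_def, mul_inner_polarPoint hu M hrz]
  simp only [norm_sq_polarPoint_add hu M]
  exact ⟨i3, i2, (mul_le_mul_of_nonneg_left hle ha0).trans hcmp⟩

omit [NeZero p] in
theorem noiseLaw_ae_ne_zero : ∀ᵐ z ∂(noiseLaw p ν pX), z ≠ 0 := by
  refine (withDensity_absolutelyContinuous _ _).ae_le ?_
  have hpos : ∀ᵐ u ∂((ν.restrict (Ioi 0)).withDensity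
      fun u => ENNReal.ofReal (u ^ ((p : ℝ) / 2 - 1) / 2)), 0 < u :=
    (withDensity_absolutelyContinuous _ _).ae_le (ae_restrict_mem measurableSet_Ioi)
  change ∀ᵐ z ∂(Measure.map (polarPoint p) _), z ≠ 0
  refine (ae_map_iff measurable_polarPoint.aemeasurable (measurableSet_singleton 0).compl).2 ?_
  filter_upwards [Measure.quasiMeasurePreserving_fst.ae hpos] with w hw
  change polarPoint p w ≠ 0
  exact norm_pos_iff.1 (by rw [norm_polarPoint]; exact Real.sqrt_pos.2 hw)

omit [NeZero p] in
theorem measurable_baranchik (a : ℝ) (hr : Measurable r) : Measurable (baranchik (p := p) a r) := by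
  unfold baranchik
  fun_prop

/-- The risk of a plug-in estimator as the mean of the loss over the noise. -/
theorem l1Risk_plugIn (hq : IsUnimodalSphericalDensity p q)
    [IsProbabilityMeasure (noiseLaw p ν pX)] {δ : Euc p → Euc p} (hδ : Measurable δ) (μ : Euc p) :
    Integrable (fun z => l1Dist p q ‖δ (z + μ) - μ‖) (noiseLaw p ν pX) ∧
    l1Risk ν pX q μ (plugIn q δ) =
      ENNReal.ofReal (∫ z, l1Dist p q ‖δ (z + μ) - μ‖ ∂(noiseLaw p ν pX)) := by
  have hL := (monotone_l1Dist hq).measurable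
  have hi : Integrable (fun z => l1Dist p q ‖δ (z + μ) - μ‖) (noiseLaw p ν pX) :=
    Integrable.of_bound (C := 2) (Measurable.aestronglyMeasurable (by fun_prop))
      (Filter.Eventually.of_forall fun z => abs_l1Dist_le hq _)
  refine ⟨hi, ?_⟩
  rw [ofReal_integral_eq_lintegral_ofReal hi
    (Filter.Eventually.of_forall fun z => l1Dist_nonneg hq (norm_nonneg _)), l1Risk]
  simp only [l1Loss_plugIn hq]
  rw [obsLaw, lintegral_map (by fun_prop) (by fun_prop)]

/-- The risk difference is bounded by the quadratic risk difference under the weighted law. The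
second order term, the mean squared change of the distance to `μ`, makes the inequality strict. -/
theorem integral_l1Dist_add_le (hp : 2 ≤ p) (hq : IsUnimodalSphericalDensity p q)
    [IsProbabilityMeasure (noiseLaw p ν pX)] {a : ℝ} (ha0 : 0 ≤ a) (hr : Measurable r) (μ : Euc p)
    (hK : Integrable (fun z => r (‖z + μ‖ ^ 2) ^ 2 * (‖z + μ‖ ^ 2)⁻¹) (weightedNoiseLaw p ν pX q))
    (hC : Integrable (fun z => r (‖z + μ‖ ^ 2) * (⟪z, z + μ⟫ * (‖z + μ‖ ^ 2)⁻¹))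
      (weightedNoiseLaw p ν pX q))
    (hKC : a * ∫ z, r (‖z + μ‖ ^ 2) ^ 2 * (‖z + μ‖ ^ 2)⁻¹ ∂(weightedNoiseLaw p ν pX q) ≤
      2 * ∫ z, r (‖z + μ‖ ^ 2) * (⟪z, z + μ⟫ * (‖z + μ‖ ^ 2)⁻¹) ∂(weightedNoiseLaw p ν pX q)) :
    Integrable (fun z => (‖baranchik a r (z + μ) - μ‖ - ‖z‖) ^ 2) (weightedNoiseLaw p ν pX q) ∧
    ∫ z, l1Dist p q ‖baranchik a r (z + μ) - μ‖ ∂(noiseLaw p ν pX) +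
      ∫ z, (‖baranchik a r (z + μ) - μ‖ - ‖z‖) ^ 2 ∂(weightedNoiseLaw p ν pX q) ≤
      ∫ z, l1Dist p q ‖z‖ ∂(noiseLaw p ν pX) := by
  have hb := measurable_baranchik (p := p) a hr
  have hJ : Integrable (fun z => (‖baranchik a r (z + μ) - μ‖ - ‖z‖) ^ 2)
      (weightedNoiseLaw p ν pX q) := by
    refine (hK.const_mul (a ^ 2)).mono' (Measurable.aestronglyMeasurable (by fun_prop))
      (Filter.Eventually.of_forall fun z => ?_)
    rw [Real.norm_of_nonneg (sq_nonneg _)]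
    exact sq_norm_sub_norm_le a r z μ
  refine ⟨hJ, ?_⟩
  have hH : Integrable (fun z => ‖baranchik a r (z + μ) - μ‖ ^ 2 - ‖z‖ ^ 2)
      (weightedNoiseLaw p ν pX q) := by
    simp only [norm_sq_baranchik_sub]
    exact (hK.const_mul _).sub (hC.const_mul _)
  have hH0 : ∫ z, (‖baranchik a r (z + μ) - μ‖ ^ 2 - ‖z‖ ^ 2) ∂(weightedNoiseLaw p ν pX q) ≤ 0 := by
    simp only [norm_sq_baranchik_sub]
    rw [integral_sub (hK.const_mul _) (hC.const_mul _), integral_const_mul, integral_const_mul]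
    nlinarith
  obtain ⟨j1, -⟩ := l1Risk_plugIn (ν := ν) (pX := pX) hq hb μ
  have j2 := (l1Risk_plugIn (ν := ν) (pX := pX) hq measurable_id μ).1
  simp only [id, add_sub_cancel_right] at j2
  have hs : Measurable fun z : Euc p => ENNReal.ofReal (lossSlope p q ‖z‖) := by
    have := measurable_lossSlope (p := p) (q := q)
    fun_prop
  have hlt : ∀ᵐ z ∂(noiseLaw p ν pX), ENNReal.ofReal (lossSlope p q ‖z‖) < ∞ :=
    Filter.Eventually.of_forall fun z => ENNReal.ofReal_lt_top
  have hHJ := hH.sub hJ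
  have hHJ' := (integrable_withDensity_iff_integrable_smul₀' hs.aemeasurable hlt).1 hHJ
  have hmain : ∫ z, (l1Dist p q ‖baranchik a r (z + μ) - μ‖ - l1Dist p q ‖z‖) ∂(noiseLaw p ν pX) ≤
      ∫ z, ((‖baranchik a r (z + μ) - μ‖ ^ 2 - ‖z‖ ^ 2) -
        (‖baranchik a r (z + μ) - μ‖ - ‖z‖) ^ 2) ∂(weightedNoiseLaw p ν pX q) := by
    rw [weightedNoiseLaw, integral_withDensity_eq_integral_toReal_smul₀ hs.aemeasurable hlt]
    refine integral_mono_ae (j1.sub j2) hHJ' ?_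
    filter_upwards [noiseLaw_ae_ne_zero] with z hz
    have := l1Dist_sub_le hp hq (norm_pos_iff.2 hz) (norm_nonneg (baranchik a r (z + μ) - μ))
    simp only [smul_eq_mul, ENNReal.toReal_ofReal (lossSlope_nonneg hp hq (norm_nonneg z))]
    linarith
  rw [integral_sub j1 j2, integral_sub hH hJ] at hmain
  linarith

/-- Some location parameter is moved by the estimator with positive weighted probability: a
countable dense set of directions covers all nonzero values of the noise. -/
theorem exists_weightedNoiseLaw_pos {a t₀ : ℝ} (hr : Monotone r) (hr1 : ∀ t, r t ≤ 1)
    (ha : 0 < a) (ht₀ : 0 < t₀) (hrt : 0 < r t₀) (hW : weightedNoiseLaw p ν pX q ≠ 0) :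
    ∃ μ : Euc p, 0 < weightedNoiseLaw p ν pX q
      (Function.support fun z => (‖baranchik a r (z + μ) - μ‖ - ‖z‖) ^ 2) := by
  have hne : ∀ᵐ z ∂(weightedNoiseLaw p ν pX q), z ≠ 0 :=
    (withDensity_absolutelyContinuous _ _).ae_le noiseLaw_ae_ne_zero
  set D := TopologicalSpace.denseSeq (Euc p) with hD
  have hcover : ∀ z : Euc p, z ≠ 0 → ∃ k, t₀ < ‖D k‖ ^ 2 ∧ a / 2 < ⟪z, D k⟫ := by
    intro z hz
    have hz0 : 0 < ‖z‖ := norm_pos_iff.2 hz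
    have hopen : IsOpen {m : Euc p | t₀ < ‖m‖ ^ 2 ∧ a / 2 < ⟪z, m⟫} := by
      have o1 : IsOpen {m : Euc p | t₀ < ‖m‖ ^ 2} := isOpen_lt (by fun_prop) (by fun_prop)
      have o2 : IsOpen {m : Euc p | a / 2 < ⟪z, m⟫} := isOpen_lt (by fun_prop) (by fun_prop)
      exact o1.inter o2
    -- The first summand makes the point long, the second one its inner product with `z` large.
    -- The first summand makes the point long, the second one its inner product with `z` large.
    have hmem : ((t₀ + 1 + a) / ‖z‖ + (t₀ + 1 + a) / ‖z‖ ^ 2) • z ∈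
        {m : Euc p | t₀ < ‖m‖ ^ 2 ∧ a / 2 < ⟪z, m⟫} := by
      have hpos : 0 < (t₀ + 1 + a) / ‖z‖ := by positivity
      have hpos2 : 0 < (t₀ + 1 + a) / ‖z‖ ^ 2 := by positivity
      constructor
      · rw [norm_smul, Real.norm_of_nonneg (by positivity)]
        have : t₀ + 1 + a ≤ ((t₀ + 1 + a) / ‖z‖ + (t₀ + 1 + a) / ‖z‖ ^ 2) * ‖z‖ := by
          rw [add_mul, div_mul_cancel₀ _ hz0.ne']
          have : 0 < (t₀ + 1 + a) / ‖z‖ ^ 2 * ‖z‖ := by positivity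
          linarith
        nlinarith
      · rw [inner_smul_right, real_inner_self_eq_norm_sq, add_mul,
          div_mul_cancel₀ _ (by positivity)]
        have : 0 < (t₀ + 1 + a) / ‖z‖ * ‖z‖ ^ 2 := by positivity
        linarith
    obtain ⟨k, hk⟩ := (TopologicalSpace.denseRange_denseSeq (Euc p)).exists_mem_open hopen ⟨_, hmem⟩
    exact ⟨k, hk⟩
  by_contra hcon
  push Not at hcon
  refine hW (ae_eq_bot.1 ?_)
  rw [← Filter.eventually_false_iff_eq_bot]
  have hall : ∀ᵐ z ∂(weightedNoiseLaw p ν pX q), ∀ k,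
      z ∉ Function.support fun z => (‖baranchik a r (z + D k) - D k‖ - ‖z‖) ^ 2 :=
    ae_all_iff.2 fun k => measure_eq_zero_iff_ae_notMem.1 (le_antisymm (hcon (D k)) zero_le)
  filter_upwards [hne, hall] with z hz hk
  obtain ⟨k, h1, h2⟩ := hcover z hz
  refine hk k ?_
  rw [Function.mem_support]
  refine pow_ne_zero 2 (sub_ne_zero.2 fun heq => ?_)
  have h3 := norm_sq_baranchik_sub a r z (D k)
  rw [heq, sub_self] at h3
  have hT : t₀ ≤ ‖z + D k‖ ^ 2 := by
    rw [norm_add_sq_real]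
    nlinarith [sq_nonneg ‖z‖]
  have hT0 : 0 < ‖z + D k‖ ^ 2 := ht₀.trans_le hT
  have hrT : 0 < r (‖z + D k‖ ^ 2) := hrt.trans_le (hr hT)
  have hin : a / 2 < ⟪z, z + D k⟫ := by
    rw [inner_add_right, real_inner_self_eq_norm_sq]
    nlinarith [sq_nonneg ‖z‖]
  have h4 : a * r (‖z + D k‖ ^ 2) - 2 * ⟪z, z + D k⟫ < 0 := by
    nlinarith [hr1 (‖z + D k‖ ^ 2)]
  have h5 : a * r (‖z + D k‖ ^ 2) * (‖z + D k‖ ^ 2)⁻¹ *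
      (a * r (‖z + D k‖ ^ 2) - 2 * ⟪z, z + D k⟫) < 0 :=
    mul_neg_of_pos_of_neg (by positivity) h4
  linarith

end Domination

theorem corollary5p2 (p : ℕ) [NeZero p] (hp : 4 ≤ p)
    -- the density to be estimated is `q(‖y - μ‖²)`
    (q : ℝ → ℝ) (hq : IsUnimodalSphericalDensity p q)
    -- the observation is `X ∼ pX(‖x - μ‖²)`
    (ν : Measure ℝ) [SigmaFinite ν] (pX : ℝ → ℝ) (hpX_meas : Measurable pX)
    (hpX_nonneg : ∀ u, 0 < u → 0 ≤ pX u) (hpX_prob : IsProbabilityMeasure (noiseLaw p ν pX))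
    (a : ℝ) (r : ℝ → ℝ)
    -- (i)
    (hr_bound : ∀ t, 0 < t → 0 ≤ r t ∧ r t ≤ 1) (hr_ne : ∃ t, 0 < t ∧ r t ≠ 0)
    -- (ii)
    (hr_mono : MonotoneOn r (Ioi 0))
    -- (iii)
    (hr_div : AntitoneOn (fun t => r t / t) (Ioi 0))
    -- (iv')
    (h_pos : 0 < ∫⁻ z, ENNReal.ofReal (deriv (marginalCdf p q) (‖z‖ / 2) / ‖z‖)
      ∂(noiseLaw p ν pX))
    (h_fin : ∫⁻ z, ENNReal.ofReal (deriv (marginalCdf p q) (‖z‖ / 2) / ‖z‖)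
      ∂(noiseLaw p ν pX) < ∞)
    -- (v')
    (ha_pos : 0 < a)
    (ha_le : ENNReal.ofReal a ≤ ENNReal.ofReal (2 * ((p : ℝ) - 2) / p) *
      (radialIntegral p ν pX q (((p : ℝ) - 3) / 2) /
        radialIntegral p ν pX q (((p : ℝ) - 5) / 2))) :
    Dominates ν pX q (plugIn q (baranchik (p := p) a r)) (plugIn q fun x : Euc p => x) := by
  have hp2 : 2 ≤ p := by omega
  have hWu : weightedNoiseLaw p ν pX q univ =
      ∫⁻ z, ENNReal.ofReal (deriv (marginalCdf p q) (‖z‖ / 2) / ‖z‖) ∂(noiseLaw p ν pX) := by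
    rw [weightedNoiseLaw, withDensity_apply _ MeasurableSet.univ, setLIntegral_univ]
    rfl
  rw [← hWu] at h_pos h_fin
  have := isFiniteMeasure_weightedRadialLaw hpX_meas h_fin
  have hW : weightedNoiseLaw p ν pX q ≠ 0 := by
    rintro h
    rw [h] at h_pos
    simp at h_pos
  have hτ0 : weightedRadialLaw p ν pX q ≠ 0 := by
    intro h
    rw [weightedNoiseLaw_univ hpX_meas, h] at h_pos
    simp at h_pos
  obtain ⟨hinv, ha⟩ := integrable_inv_and_mul_le hp hpX_meas hpX_nonneg hτ0 ha_pos ha_le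
  -- Extending `r` by `0` makes it monotone on `ℝ` and does not change the estimator.
  set r' : ℝ → ℝ := fun t => if 0 < t then r t else 0 with hr'
  have hr0 : ∀ t, 0 ≤ r' t := fun t => by
    simp only [hr']; split_ifs with h
    exacts [(hr_bound t h).1, le_rfl]
  have hr1 : ∀ t, r' t ≤ 1 := fun t => by
    simp only [hr']; split_ifs with h
    exacts [(hr_bound t h).2, zero_le_one]
  have hrz : r' 0 = 0 := by simp [hr']
  have hrm : Monotone r' := fun s t hst => by
    by_cases hs : 0 < s
    · simp only [hr', if_pos hs, if_pos (hs.trans_le hst)]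
      exact hr_mono hs (hs.trans_le hst) hst
    · have : r' s = 0 := if_neg hs
      rw [this]; exact hr0 t
  have hbar : baranchik (p := p) a r = baranchik a r' := by
    ext1 x
    unfold baranchik
    rcases eq_or_ne x 0 with h | h
    · simp [h]
    · have h0 : 0 < ‖x‖ ^ 2 := by have := norm_pos_iff.2 h; positivity
      simp only [hr', if_pos h0]
  obtain ⟨t₀, ht₀, hrt⟩ := hr_ne
  have hrt' : 0 < r' t₀ := by
    simp only [hr', if_pos ht₀]
    exact lt_of_le_of_ne (hr_bound t₀ ht₀).1 hrt.symm
  rw [hbar]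
  have key : ∀ μ : Euc p,
      Integrable (fun z => (‖baranchik a r' (z + μ) - μ‖ - ‖z‖) ^ 2) (weightedNoiseLaw p ν pX q) ∧
      ∫ z, l1Dist p q ‖baranchik a r' (z + μ) - μ‖ ∂(noiseLaw p ν pX) +
        ∫ z, (‖baranchik a r' (z + μ) - μ‖ - ‖z‖) ^ 2 ∂(weightedNoiseLaw p ν pX q) ≤
        ∫ z, l1Dist p q ‖z‖ ∂(noiseLaw p ν pX) := by
    intro μ
    obtain ⟨hK, hC, hKC⟩ := weighted_quadratic_bound hp hpX_meas hτ0 hinv ha_pos.le ha hrm hr0 hr1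
      hrz μ
    exact integral_l1Dist_add_le hp2 hq ha_pos.le hrm.measurable μ hK hC hKC
  have risk1 := fun μ => (l1Risk_plugIn (ν := ν) (pX := pX) hq
    (measurable_baranchik (p := p) a hrm.measurable) μ).2
  have risk2 : ∀ μ : Euc p, l1Risk ν pX q μ (plugIn q fun x : Euc p => x) =
      ENNReal.ofReal (∫ z, l1Dist p q ‖z‖ ∂(noiseLaw p ν pX)) := fun μ => by
    have := (l1Risk_plugIn (ν := ν) (pX := pX) hq measurable_id μ).2
    simp only [id, add_sub_cancel_right] at this
    exact this
  refine ⟨fun μ => ?_, ?_⟩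
  · rw [risk1, risk2]
    have hJ : 0 ≤ ∫ z, (‖baranchik a r' (z + μ) - μ‖ - ‖z‖) ^ 2 ∂(weightedNoiseLaw p ν pX q) :=
      integral_nonneg fun _ => sq_nonneg _
    exact ENNReal.ofReal_le_ofReal (by linarith [(key μ).2])
  · obtain ⟨μ, hμ⟩ := exists_weightedNoiseLaw_pos hrm hr1 ha_pos ht₀ hrt' hW
    refine ⟨μ, ?_⟩
    rw [risk1, risk2]
    have hJ : 0 < ∫ z, (‖baranchik a r' (z + μ) - μ‖ - ‖z‖) ^ 2 ∂(weightedNoiseLaw p ν pX q) :=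
      (integral_pos_iff_support_of_nonneg (fun _ => sq_nonneg _) (key μ).1).2 hμ
    have h1 : 0 ≤ ∫ z, l1Dist p q ‖baranchik a r' (z + μ) - μ‖ ∂(noiseLaw p ν pX) :=
      integral_nonneg fun z => l1Dist_nonneg hq (norm_nonneg _)
    have h2 := (key μ).2
    exact (ENNReal.ofReal_lt_ofReal_iff_of_nonneg h1).2 (by linarith)
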